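/- **Setting.** Let $(X,\Sigma,\mathfrak m)$ be a $\sigma$-finite measure space, $\mathbb B$ a real Banach space (not necessarily separable), and $p,q\in(1,\infty)$ with $\frac1p+\frac1q=1$. Let $\mathbf E$ be a Banach $\mathbb B$-bundle over $X$: a map assigning to each $x\in X$ a closed linear subspace $\mathbf E(x)\subseteq\mathbb B$ such that $\{x:\mathbf E(x)\cap U\neq\varnothing\}\in\Sigma$ for every open $U\subseteq\mathbb B$. Measurability of maps is understood with respect to the completion of $\mathfrak m$ (if $\mathfrak m$ is complete, this is ordinary measurability). A *section* of $\mathbf E$ is a map $\bar v\colon X\to\mathbb B$ with $\bar v(x)\in\mathbf E(x)$ for all $x$ that is strongly measurable (weakly measurable and, off a null set, separably valued). $\Gamma_p(\mathbf E)$ is the space of $\mathfrak m$-a.e. classes of sections with $|v|:=\|\bar v(\cdot)\|_{\mathbb B}\in L^p(\mathfrak m)$, with the norm $\||v|\|_{L^p(\mathfrak m)}$. A *weakly\* measurable section of the dual bundle* is a map $x\mapsto\bar\omega(x)\in\mathbf E(x)'$ such that $x\mapsto\langle\bar\omega(x),\bar v(x)\rangle$ is measurable for every section $\bar v$ of $\mathbf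 E$; two of them, $\bar\omega$ and $\bar\eta$, are identified if for every section $\bar v$ one has $\langle\bar\omega(x)-\bar\eta(x),\bar v(x)\rangle=0$ for $\mathfrak m$-a.e. $x$. On the quotient space, let $|\omega|$ be the essential supremum, i.e. the least upper bound for the $\mathfrak m$-a.e. order, of the family $\langle\bar\omega(\cdot),\bar v(\cdot)\rangle$, where $\bar v$ ranges over the sections with $|\bar v|\le1$; let $\Gamma_q(\mathbf E'_{w^*})$ be the $L^\infty(\mathfrak m)$-module of all $\omega$ with $|\omega|\in L^q(\mathfrak m)$. An *$L^q(\mathfrak m)$-normed $L^\infty(\mathfrak m)$-module* is an $L^\infty(\mathfrak m)$-module $\mathscr M$ with a map $|\cdot|\colon\mathscr M\to L^q(\mathfrak m)$ such that, $\mathfrak m$-a.e., $|v|\ge0$ with equality iff $v=0$, $|v+w|\le|v|+|w|$ and $|f\cdot v|=|f||v|$ for all $v,w\in\mathscr M$ and $f\in L^\infty(\mathfrak m)$; it is an *$L^q(\mathfrak m)$-Banach $L^\infty(\mathfrak m)$-module* if it is complete for the norm $v\mapsto\||v|\|_{L^q(\mathfrak m)}$. The *module dual* $\Gamma_p(\mathbf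 E)^*$ is the $L^\infty(\mathfrak m)$-module of all continuous $L^\infty(\mathfrak m)$-linear maps $T\colon\Gamma_p(\mathbf E)\to L^1(\mathfrak m)$, with pointwise norm $|T|:=\bigvee\{T(v):v\in\Gamma_p(\mathbf E),\ |v|\le1\ \mathfrak m\text{-a.e.}\}$ (essential supremum of the family). **Theorem.** With these pointwise norms, $\Gamma_p(\mathbf E)^*$ is an $L^q(\mathfrak m)$-Banach $L^\infty(\mathfrak m)$-module (in particular $|T|\in L^q(\mathfrak m)$ for every $T$), and $$\Gamma_q(\mathbf E'_{w^*})\cong\Gamma_p(\mathbf E)^*$$ as $L^q(\mathfrak m)$-normed $L^\infty(\mathfrak m)$-modules. More precisely, there is an $L^\infty(\mathfrak m)$-linear bijection $\mathrm I\colon\Gamma_q(\mathbf E'_{w^*})\to\Gamma_p(\mathbf E)^*$ with $|\mathrm I(\omega)|=|\omega|$ $\mathfrak m$-a.e. for every $\omega$, given by $$\mathrm I(\omega)(v)(x)=\langle\bar\omega(x),\bar v(x)\rangle\quad\text{for }\mathfrak m\text{-a.e. }x\in X,$$ for all representatives $\bar\omega$ of $\omega\in\Gamma_q(\mathbf E'_{w^*})$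 and $\bar v$ of $v\in\Gamma_p(\mathbf E)$. In particular, $\Gamma_q(\mathbf E'_{w^*})$ is an $L^q(\mathfrak m)$-Banach $L^\infty(\mathfrak m)$-module. -/

import Mathlib

open MeasureTheory Filter
open scoped ENNReal

noncomputable section

namespace BundleDual

/-! ### The rings `L⁰(μ)` and `L^∞(μ)` -/

section Rings

variable {X : Type*} [MeasurableSpace X] {μ : Measure X}

/-- `L⁰(μ)`, real measurable functions up to a.e. equality, is a commutative ring. -/
instance instCommRingL0 : CommRing (X →ₘ[μ] ℝ) :=
  { (inferInstance : AddCommGroup (X →ₘ[μ] ℝ)), (inferInstance : CommMonoid (X →ₘ[μ] ℝ)) with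
    left_distrib := by
      rintro ⟨a⟩ ⟨b⟩ ⟨c⟩
      exact congrArg (Quot.mk _) (Subtype.ext (mul_add a.1 b.1 c.1))
    right_distrib := by
      rintro ⟨a⟩ ⟨b⟩ ⟨c⟩
      exact congrArg (Quot.mk _) (Subtype.ext (add_mul a.1 b.1 c.1))
    zero_mul := by
      rintro ⟨a⟩
      exact congrArg (Quot.mk _) (Subtype.ext (zero_mul a.1))
    mul_zero := by
      rintro ⟨a⟩
      exact congrArg (Quot.mk _) (Subtype.ext (mul_zero a.1)) }

variable (μ) in
/-- `L^∞(μ)`: the subring of essentially bounded elements of `L⁰(μ)`. -/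
def Linf : Subring (X →ₘ[μ] ℝ) where
  carrier := {f | MemLp f ∞ μ}
  mul_mem' {f g} hf hg := (hg.mul' hf).ae_eq (AEEqFun.coeFn_mul f g).symm
  one_mem' := (memLp_top_const (1 : ℝ)).ae_eq AEEqFun.coeFn_one.symm
  add_mem' {f g} hf hg := (hf.add hg).ae_eq (AEEqFun.coeFn_add f g).symm
  zero_mem' := (memLp_top_const (0 : ℝ)).ae_eq AEEqFun.coeFn_zero.symm
  neg_mem' {f} hf := hf.neg.ae_eq (AEEqFun.coeFn_neg f).symm

lemma Linf.memLp (f : Linf μ) : MemLp (f : X →ₘ[μ] ℝ) ∞ μ := f.2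

end Rings

section LpModule

variable {X : Type*} [MeasurableSpace X] {μ : Measure X}
variable {B : Type*} [NormedAddCommGroup B] [NormedSpace ℝ B] {p : ℝ≥0∞}

/-- Pointwise multiplication of elements of `L^p(μ; B)` by elements of `L^∞(μ)`. -/
instance instSMulLp : SMul (Linf μ) (Lp B p μ) where
  smul f v := ((Lp.memLp v).smul (r := p) (Linf.memLp f)).toLp
    (((f : X →ₘ[μ] ℝ) : X → ℝ) • (v : X → B))

lemma coeFn_linf_smul (f : Linf μ) (v : Lp B p μ) :
    (f • v : Lp B p μ) =ᵐ[μ] fun x => (f : X →ₘ[μ] ℝ) x • v x :=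
  MemLp.coeFn_toLp _

instance instModuleLp : Module (Linf μ) (Lp B p μ) where
  one_smul v := by
    apply Lp.ext
    filter_upwards [coeFn_linf_smul (1 : Linf μ) v,
      (AEEqFun.coeFn_one : ((1 : X →ₘ[μ] ℝ) : X → ℝ) =ᵐ[μ] 1)] with x h1 h2
    rw [h1, Subring.coe_one, h2, Pi.one_apply, one_smul]
  mul_smul f g v := by
    apply Lp.ext
    filter_upwards [coeFn_linf_smul (f * g) v, coeFn_linf_smul f (g • v), coeFn_linf_smul g v,
      AEEqFun.coeFn_mul (f : X →ₘ[μ] ℝ) (g : X →ₘ[μ] ℝ)] with x h1 h2 h3 h4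
    rw [h1, h2, h3, Subring.coe_mul, h4, Pi.mul_apply, mul_smul]
  smul_zero f := by
    apply Lp.ext
    filter_upwards [coeFn_linf_smul f (0 : Lp B p μ), Lp.coeFn_zero B p μ] with x h1 h2
    rw [h1, h2, Pi.zero_apply, smul_zero]
  smul_add f v w := by
    apply Lp.ext
    filter_upwards [coeFn_linf_smul f (v + w), coeFn_linf_smul f v, coeFn_linf_smul f w,
      Lp.coeFn_add v w, Lp.coeFn_add (f • v) (f • w)] with x h1 h2 h3 h4 h5
    rw [h1, h5, Pi.add_apply, h2, h3, h4, Pi.add_apply, smul_add]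
  add_smul f g v := by
    apply Lp.ext
    filter_upwards [coeFn_linf_smul (f + g) v, coeFn_linf_smul f v, coeFn_linf_smul g v,
      AEEqFun.coeFn_add (f : X →ₘ[μ] ℝ) (g : X →ₘ[μ] ℝ),
      Lp.coeFn_add (f • v) (g • v)] with x h1 h2 h3 h4 h5
    rw [h1, h5, Pi.add_apply, h2, h3, Subring.coe_add, h4, Pi.add_apply, add_smul]
  zero_smul v := by
    apply Lp.ext
    filter_upwards [coeFn_linf_smul (0 : Linf μ) v, Lp.coeFn_zero B p μ,
      (AEEqFun.coeFn_zero : ((0 : X →ₘ[μ] ℝ) : X → ℝ) =ᵐ[μ] 0)] with x h1 h2 h3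
    rw [h1, h2, Subring.coe_zero, h3, Pi.zero_apply, Pi.zero_apply, zero_smul]

instance instContinuousConstSMulLp [Fact (1 ≤ p)] : ContinuousConstSMul (Linf μ) (Lp B p μ) where
  continuous_const_smul f := by
    refine (LipschitzWith.of_dist_le_mul (K := (eLpNorm (f : X →ₘ[μ] ℝ) ∞ μ).toNNReal)
      fun v w => ?_).continuous
    rw [dist_eq_norm, dist_eq_norm, ← smul_sub, Lp.norm_def, Lp.norm_def,
      ← ENNReal.coe_toReal, ENNReal.coe_toNNReal (Linf.memLp f).2.ne, ← ENNReal.toReal_mul]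
    refine ENNReal.toReal_mono (ENNReal.mul_ne_top (Linf.memLp f).2.ne (Lp.eLpNorm_ne_top _)) ?_
    rw [eLpNorm_congr_ae (coeFn_linf_smul f (v - w))]
    exact eLpNorm_smul_le_mul_eLpNorm (Lp.aestronglyMeasurable (v - w)) (Linf.memLp f).1

end LpModule

/-! ### Extended-real-valued functions and essential suprema of families -/

section EssSup

variable {X : Type*} [MeasurableSpace X] {μ : Measure X}

/-- The inclusion of `L⁰(μ)` into the space of extended-real-valued measurable functions up to
a.e. equality. -/
def toExt (f : X →ₘ[μ] ℝ) : X →ₘ[μ] EReal :=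
  AEEqFun.comp Real.toEReal continuous_coe_real_ereal f

lemma coeFn_toExt (f : X →ₘ[μ] ℝ) : toExt f =ᵐ[μ] fun x => ((f x : ℝ) : EReal) :=
  AEEqFun.coeFn_comp _ _ _

/-- Over a `σ`-finite measure, every family of extended-real-valued measurable functions has a
least upper bound for the a.e. order. -/
theorem exists_isLUB [SigmaFinite μ] (S : Set (X →ₘ[μ] EReal)) : ∃ g, IsLUB S g := by
  classical
  have key : ∀ r : ℚ, ∃ D ⊆ S, D.Countable ∧
      ∀ f ∈ S, ∀ᵐ x ∂μ, ((r : ℝ) : EReal) < f x → ∃ g ∈ D, ((r : ℝ) : EReal) < g x := by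
    intro r
    let F : (X →ₘ[μ] EReal) → Set X := fun f => {x | ((r : ℝ) : EReal) < f x}
    obtain ⟨D, hDS, hDc, hD⟩ := Measure.exists_ae_subset_biUnion_countable μ (C := F '' S) (by
      rintro _ ⟨f, -, rfl⟩
      exact measurableSet_lt measurable_const f.measurable)
    choose g hgS hgF using fun s : D => hDS s.2
    have : Countable D := hDc
    refine ⟨Set.range g, by rintro _ ⟨s, rfl⟩; exact hgS s, Set.countable_range g, fun f hf => ?_⟩
    filter_upwards [hD (F f) ⟨f, hf, rfl⟩] with x hx hlt
    obtain ⟨s, hs, hxs⟩ := hx hlt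
    refine ⟨g ⟨s, hs⟩, ⟨⟨s, hs⟩, rfl⟩, ?_⟩
    have h := hgF ⟨s, hs⟩
    exact (Set.ext_iff.1 h x).2 hxs
  choose D hDS hDc hD using key
  let C : Set (X →ₘ[μ] EReal) := ⋃ r, D r
  have hC : C.Countable := Set.countable_iUnion hDc
  have hm : AEStronglyMeasurable (fun x => ⨆ g ∈ C, (g : X → EReal) x) μ :=
    (AEMeasurable.biSup C hC fun g _ => g.aestronglyMeasurable.aemeasurable).aestronglyMeasurable
  refine ⟨AEEqFun.mk _ hm, ?_, ?_⟩
  · intro f hf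
    rw [← AEEqFun.coeFn_le]
    filter_upwards [AEEqFun.coeFn_mk _ hm, ae_all_iff.2 fun r => hD r f hf] with x h1 h2
    rw [h1]
    by_contra hlt
    obtain ⟨r, hr1, hr2⟩ := EReal.exists_rat_btwn_of_lt (not_le.1 hlt)
    obtain ⟨g, hg, hg'⟩ := h2 r hr2
    exact absurd (le_iSup₂ (f := fun g (_ : g ∈ C) => (g : X → EReal) x) g
      (Set.mem_iUnion.2 ⟨r, hg⟩)) (not_le.2 (hr1.trans hg'))
  · intro u hu
    rw [← AEEqFun.coeFn_le]
    have : ∀ᵐ x ∂μ, ∀ g ∈ C, (g : X → EReal) x ≤ u x :=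
      (ae_ball_iff hC).2 fun g hg => by
        obtain ⟨r, hr⟩ := Set.mem_iUnion.1 hg
        exact AEEqFun.coeFn_le.2 (hu (hDS r hr))
    filter_upwards [AEEqFun.coeFn_mk _ hm, this] with x h1 h2
    rw [h1]
    exact iSup₂_le h2

/-- The essential supremum `⋁ S` of a (possibly uncountable) family: its least upper bound for the
a.e. order. -/
def famSup [SigmaFinite μ] (S : Set (X →ₘ[μ] EReal)) : X →ₘ[μ] EReal := (exists_isLUB S).choose

lemma isLUB_famSup [SigmaFinite μ] (S : Set (X →ₘ[μ] EReal)) : IsLUB S (famSup S) :=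
  (exists_isLUB S).choose_spec

end EssSup

/-! ### `L^p`-normed `L^∞`-modules and their duals -/

section Modules

variable {X : Type*} [MeasurableSpace X] {μ : Measure X}

/-- `N` is an `L^p`-pointwise norm on the `L^∞(μ)`-module `M`, that is, `(M, N)` is an
`L^p`-normed `L^∞`-module. -/
structure IsLpNormedModule (p : ℝ≥0∞) {M : Type*} [AddCommGroup M] [Module (Linf μ) M]
    (N : M → Lp ℝ p μ) : Prop where
  nonneg : ∀ v, 0 ≤ᵐ[μ] N v
  eq_zero_iff : ∀ v, N v =ᵐ[μ] 0 ↔ v = 0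
  add_le : ∀ v w, N (v + w) ≤ᵐ[μ] fun x => N v x + N w x
  smul_eq : ∀ (f : Linf μ) (v : M), N (f • v) =ᵐ[μ] fun x => |(f : X →ₘ[μ] ℝ) x| * N v x

/-- `(M, N)` is an `L^p`-Banach `L^∞`-module: it is complete for the norm `v ↦ ‖N v‖_{L^p}`. -/
structure IsLpBanachModule (p : ℝ≥0∞) {M : Type*} [AddCommGroup M] [Module (Linf μ) M]
    (N : M → Lp ℝ p μ) : Prop extends IsLpNormedModule p N where
  complete : ∀ u : ℕ → M,
    (∀ ε > 0, ∃ n₀, ∀ m ≥ n₀, ∀ n ≥ n₀, ‖N (u m - u n)‖ < ε) →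
      ∃ v, Tendsto (fun n => ‖N (u n - v)‖) atTop (nhds 0)

variable (μ) in
/-- The module dual: continuous `L^∞(μ)`-linear maps into `L¹(μ)`. -/
abbrev ModuleDual (M : Type*) [AddCommGroup M] [TopologicalSpace M] [Module (Linf μ) M] : Type _ :=
  M →L[Linf μ] Lp ℝ 1 μ

/-- The pointwise norm `|T| = ⋁ {T v : |v| ≤ 1 a.e.}` of an element of the module dual, as an
extended-real-valued measurable function up to a.e. equality. -/
def dualPtNorm [SigmaFinite μ] {p : ℝ≥0∞} {M : Type*} [AddCommGroup M] [TopologicalSpace M]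
    [Module (Linf μ) M] (N : M → Lp ℝ p μ) (T : ModuleDual μ M) : X →ₘ[μ] EReal :=
  famSup {g | ∃ v : M, (∀ᵐ x ∂μ, N v x ≤ 1) ∧ g = toExt (T v : X →ₘ[μ] ℝ)}

end Modules

/-! ### Banach bundles and their sections -/

/-- A Banach `B`-bundle over `X`: a weakly measurable multivalued map whose values are closed linear
subspaces of `B`. -/
structure BanachBundle (X : Type*) [MeasurableSpace X] (B : Type*) [NormedAddCommGroup B]
    [NormedSpace ℝ B] where
  fiber : X → Submodule ℝ B
  isClosed_fiber : ∀ x, IsClosed (fiber x : Set B)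
  weaklyMeasurable : ∀ U : Set B, IsOpen U → MeasurableSet {x | ((fiber x : Set B) ∩ U).Nonempty}

section Bundles

variable {X : Type*} [MeasurableSpace X] (μ : Measure X)
variable {B : Type*} [NormedAddCommGroup B] [NormedSpace ℝ B] (E : BanachBundle X B)

/-- The sections of `E`: strongly measurable selections. Measurability of maps is understood with
respect to the completion of `μ`: `AEStronglyMeasurable v μ` says that `v` is weakly measurable with
respect to the completion and essentially separably valued. -/
def Sec : Submodule ℝ (∀ x, E.fiber x) where
  carrier := {v | AEStronglyMeasurable (fun x => (v x : B)) μ}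
  add_mem' hv hw := AEStronglyMeasurable.add hv hw
  zero_mem' := aestronglyMeasurable_const (b := (0 : B))
  smul_mem' c _ hv := AEStronglyMeasurable.const_smul hv c

variable {E μ} in
lemma Sec.aestronglyMeasurable (v : Sec μ E) : AEStronglyMeasurable (fun x => (v.1 x : B)) μ := v.2

variable (p : ℝ≥0∞)

/-- `Γ_p(E)`: the classes in `L^p(μ; B)` that have a section of `E` as a representative. -/
def Gam : Submodule (Linf μ) (Lp B p μ) where
  carrier := {u | ∃ v : Sec μ E, u =ᵐ[μ] fun x => (v.1 x : B)}
  add_mem' := by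
    rintro u w ⟨v, hv⟩ ⟨v', hv'⟩
    refine ⟨v + v', ?_⟩
    filter_upwards [Lp.coeFn_add u w, hv, hv'] with x h1 h2 h3
    rw [h1, Pi.add_apply, h2, h3]
    rfl
  zero_mem' := ⟨0, Lp.coeFn_zero B p μ⟩
  smul_mem' := by
    rintro f u ⟨v, hv⟩
    refine ⟨⟨fun x => (f : X →ₘ[μ] ℝ) x • v.1 x,
      (f : X →ₘ[μ] ℝ).aestronglyMeasurable.smul (Sec.aestronglyMeasurable v)⟩, ?_⟩
    filter_upwards [coeFn_linf_smul f u, hv] with x h1 h2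
    rw [h1, h2]
    rfl

variable {μ E p} in
/-- The class in `Γ_p(E)` of a `p`-integrable section. -/
def Gam.mk (v : Sec μ E) (hv : MemLp (fun x => (v.1 x : B)) p μ) : Gam μ E p :=
  ⟨hv.toLp, v, hv.coeFn_toLp⟩

variable {μ E p} in
/-- The pointwise norm `|v| = ‖v(·)‖` on `Γ_p(E)`. -/
def Gam.ptNorm (v : Gam μ E p) : Lp ℝ p μ := (Lp.memLp (v : Lp B p μ)).norm.toLp

/-! ### Weakly* measurable sections of the dual bundle -/

/-- Weakly* measurable sections of the dual bundle `x ↦ E(x)'`: those whose pairing with every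
section of `E` is measurable with respect to the completion of `μ` (for real functions this is
`AEStronglyMeasurable`). -/
def WSec : Submodule ℝ (∀ x, StrongDual ℝ (E.fiber x)) where
  carrier := {ω | ∀ v : Sec μ E, AEStronglyMeasurable (fun x => ω x (v.1 x)) μ}
  add_mem' hω hη v := (hω v).add (hη v)
  zero_mem' _ := aestronglyMeasurable_const (b := (0 : ℝ))
  smul_mem' c _ hω v := (hω v).const_smul c

instance WSec.instAddCommGroup : AddCommGroup (WSec μ E) := Submodule.addCommGroup (WSec μ E)

/-- The elements of `WSec` that pair to zero a.e. with each section of `E`. -/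
def wNull : Submodule ℝ (WSec μ E) where
  carrier := {ω | ∀ v : Sec μ E, ∀ᵐ x ∂μ, ω.1 x (v.1 x) = 0}
  add_mem' {ω η} hω hη v := by
    filter_upwards [hω v, hη v] with x h1 h2
    change ω.1 x (v.1 x) + η.1 x (v.1 x) = 0
    rw [h1, h2, add_zero]
  zero_mem' _ := Eventually.of_forall fun _ => rfl
  smul_mem' c ω hω v := by
    filter_upwards [hω v] with x h1
    change c • ω.1 x (v.1 x) = 0
    rw [h1, smul_zero]

/-- `Γ₀(E'_{w*})`: weakly* measurable sections of the dual bundle, two of them being identified when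
for every section `v` of `E` their pairings with `v` agree a.e. -/
abbrev GamW₀ : Type _ := WSec μ E ⧸ wNull μ E

variable {μ E}

/-- The class in `Γ₀(E'_{w*})` of a weakly* measurable section. -/
abbrev GamW₀.mk (ω : WSec μ E) : GamW₀ μ E := (wNull μ E).mkQ ω

/-- Pointwise multiplication of a weakly* measurable section by an element of `L⁰(μ)` (through a
representative of the latter). -/
def WSec.mul (f : X →ₘ[μ] ℝ) : WSec μ E →ₗ[ℝ] WSec μ E where
  toFun ω := ⟨fun x => f x • ω.1 x, fun v => f.aestronglyMeasurable.smul (ω.2 v)⟩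
  map_add' ω η := Subtype.ext (funext fun x => smul_add (f x) (ω.1 x) (η.1 x))
  map_smul' c ω := Subtype.ext (funext fun x => smul_comm (f x) c (ω.1 x))

lemma WSec.mul_apply (f : X →ₘ[μ] ℝ) (ω : WSec μ E) (x : X) (e : E.fiber x) :
    (WSec.mul f ω).1 x e = f x * ω.1 x e := rfl

lemma GamW₀.mk_eq_mk {ω η : WSec μ E} : GamW₀.mk ω = GamW₀.mk η ↔
    ∀ v : Sec μ E, ∀ᵐ x ∂μ, ω.1 x (v.1 x) = η.1 x (v.1 x) := by
  refine (Submodule.Quotient.eq (wNull μ E)).trans ?_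
  refine forall_congr' fun v => eventually_congr (Eventually.of_forall fun x => ?_)
  exact sub_eq_zero (a := ω.1 x (v.1 x)) (b := η.1 x (v.1 x))

instance GamW₀.instSMul : SMul (X →ₘ[μ] ℝ) (GamW₀ μ E) where
  smul f := (wNull μ E).mapQ (wNull μ E) (WSec.mul f) fun ω hω v => by
    filter_upwards [hω v] with x hx
    rw [WSec.mul_apply, hx, mul_zero]

lemma GamW₀.smul_mk (f : X →ₘ[μ] ℝ) (ω : WSec μ E) :
    f • GamW₀.mk ω = GamW₀.mk (WSec.mul f ω) := rfl

/-- The `L⁰(μ)`-module structure of `Γ₀(E'_{w*})`. -/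
instance GamW₀.instModule : Module (X →ₘ[μ] ℝ) (GamW₀ μ E) where
  one_smul ω := by
    obtain ⟨ω, rfl⟩ := Submodule.mkQ_surjective _ ω
    refine GamW₀.mk_eq_mk.2 fun v => ?_
    filter_upwards [(AEEqFun.coeFn_one : ((1 : X →ₘ[μ] ℝ) : X → ℝ) =ᵐ[μ] 1)] with x hx
    rw [WSec.mul_apply, hx, Pi.one_apply, one_mul]
  mul_smul f g ω := by
    obtain ⟨ω, rfl⟩ := Submodule.mkQ_surjective _ ω
    refine GamW₀.mk_eq_mk.2 fun v => ?_
    filter_upwards [AEEqFun.coeFn_mul f g] with x hx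
    rw [WSec.mul_apply, WSec.mul_apply, WSec.mul_apply, hx, Pi.mul_apply, mul_assoc]
  smul_zero f := map_zero ((wNull μ E).mapQ (wNull μ E) (WSec.mul f) _)
  smul_add f := map_add ((wNull μ E).mapQ (wNull μ E) (WSec.mul f) _)
  add_smul f g ω := by
    obtain ⟨ω, rfl⟩ := Submodule.mkQ_surjective _ ω
    refine GamW₀.mk_eq_mk.2 fun v => ?_
    filter_upwards [AEEqFun.coeFn_add f g] with x hx
    change (f + g) x * ω.1 x (v.1 x) = f x * ω.1 x (v.1 x) + g x * ω.1 x (v.1 x)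
    rw [hx, Pi.add_apply, add_mul]
  zero_smul ω := by
    obtain ⟨ω, rfl⟩ := Submodule.mkQ_surjective _ ω
    refine GamW₀.mk_eq_mk.2 fun v => ?_
    filter_upwards [(AEEqFun.coeFn_zero : ((0 : X →ₘ[μ] ℝ) : X → ℝ) =ᵐ[μ] 0)] with x hx
    rw [WSec.mul_apply, hx, Pi.zero_apply, zero_mul]
    rfl

/-- The pairing `⟨ω(·), v(·)⟩` with a section `v`, on representatives. -/
def WSec.pair (v : Sec μ E) : WSec μ E →ₗ[ℝ] (X →ₘ[μ] ℝ) where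
  toFun ω := AEEqFun.mk (fun x => ω.1 x (v.1 x)) (ω.2 v)
  map_add' _ _ := rfl
  map_smul' _ _ := rfl

/-- The pairing `⟨ω(·), v(·)⟩` of a class `ω` in `Γ₀(E'_{w*})` with a section `v`. -/
def GamW₀.pair (v : Sec μ E) : GamW₀ μ E →ₗ[ℝ] (X →ₘ[μ] ℝ) :=
  (wNull μ E).liftQ (WSec.pair v) fun _ hω => AEEqFun.mk_eq_mk.2 (hω v)

lemma GamW₀.pair_mk (v : Sec μ E) (ω : WSec μ E) :
    GamW₀.pair v (GamW₀.mk ω) = AEEqFun.mk (fun x => ω.1 x (v.1 x)) (ω.2 v) := rfl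

variable [SigmaFinite μ]

/-- The pointwise norm `|ω| = ⋁ {⟨ω(·), v(·)⟩ : |v| ≤ 1}` on `Γ₀(E'_{w*})`, as an
extended-real-valued measurable function up to a.e. equality. -/
def GamW₀.ptNorm (ω : GamW₀ μ E) : X →ₘ[μ] EReal :=
  famSup {g | ∃ v : Sec μ E, (∀ᵐ x ∂μ, ‖v.1 x‖ ≤ 1) ∧ g = toExt (GamW₀.pair v ω)}

lemma GamW₀.le_ptNorm (ω : GamW₀ μ E) (v : Sec μ E) (hv : ∀ᵐ x ∂μ, ‖v.1 x‖ ≤ 1) :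
    ∀ᵐ x ∂μ, ((GamW₀.pair v ω x : ℝ) : EReal) ≤ GamW₀.ptNorm ω x := by
  have h := AEEqFun.coeFn_le.2 ((isLUB_famSup _).1 ⟨v, hv, rfl⟩ :
    toExt (GamW₀.pair v ω) ≤ GamW₀.ptNorm ω)
  filter_upwards [h, coeFn_toExt (GamW₀.pair v ω)] with x h1 h2
  rwa [← h2]

lemma GamW₀.ptNorm_nonneg (ω : GamW₀ μ E) : ∀ᵐ x ∂μ, 0 ≤ GamW₀.ptNorm ω x := by
  obtain ⟨ω, rfl⟩ := Submodule.mkQ_surjective _ ω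
  filter_upwards [GamW₀.le_ptNorm (GamW₀.mk ω) 0 (Eventually.of_forall fun x => by simp),
    AEEqFun.coeFn_mk _ (ω.2 (0 : Sec μ E))] with x h1 h2
  have h3 : GamW₀.pair 0 (GamW₀.mk ω) x = 0 := h2.trans (map_zero (ω.1 x))
  rwa [h3, EReal.coe_zero] at h1

/-- If every pairing of `ω` with a section bounded by `1` is a.e. at most `g ∈ L^q`, then the
pointwise norm of `ω` is the class of an element of `L^q`. -/
lemma GamW₀.exists_of_le {q : ℝ≥0∞} (ω : GamW₀ μ E) (g : X → ℝ) (hg : MemLp g q μ)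
    (h : ∀ v : Sec μ E, (∀ᵐ x ∂μ, ‖v.1 x‖ ≤ 1) → ∀ᵐ x ∂μ, GamW₀.pair v ω x ≤ g x) :
    ∃ k : Lp ℝ q μ, toExt (k : X →ₘ[μ] ℝ) = GamW₀.ptNorm ω := by
  have hle : ∀ᵐ x ∂μ, GamW₀.ptNorm ω x ≤ ((g x : ℝ) : EReal) := by
    have h1 : GamW₀.ptNorm ω ≤ toExt (hg.toLp g : X →ₘ[μ] ℝ) := by
      refine (isLUB_famSup _).2 ?_
      rintro _ ⟨v, hv, rfl⟩
      rw [← AEEqFun.coeFn_le]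
      filter_upwards [h v hv, coeFn_toExt (GamW₀.pair v ω),
        coeFn_toExt (hg.toLp g : X →ₘ[μ] ℝ), hg.coeFn_toLp] with x h1 h2 h3 h4
      rw [h2, h3, h4]
      exact EReal.coe_le_coe_iff.2 h1
    filter_upwards [AEEqFun.coeFn_le.2 h1, coeFn_toExt (hg.toLp g : X →ₘ[μ] ℝ),
      hg.coeFn_toLp] with x h2 h3 h4
    rwa [h3, h4] at h2
  have hm : MemLp (fun x => (GamW₀.ptNorm ω x).toReal) q μ := by
    refine hg.mono (GamW₀.ptNorm ω).measurable.ereal_toReal.aestronglyMeasurable ?_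
    filter_upwards [hle, GamW₀.ptNorm_nonneg ω] with x h1 h2
    rw [Real.norm_of_nonneg (EReal.toReal_nonneg h2)]
    refine le_trans ?_ (Real.le_norm_self _)
    rw [← EReal.toReal_coe (g x)]
    exact EReal.toReal_le_toReal h1 (ne_of_gt (EReal.bot_lt_zero.trans_le h2))
      (EReal.coe_ne_top _)
  refine ⟨hm.toLp, ?_⟩
  refine AEEqFun.ext ?_
  filter_upwards [coeFn_toExt (hm.toLp : X →ₘ[μ] ℝ), hm.coeFn_toLp, hle,
    GamW₀.ptNorm_nonneg ω] with x h1 h2 h3 h4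
  rw [h1, h2]
  exact EReal.coe_toReal (ne_of_lt (h3.trans_lt (EReal.coe_lt_top _)))
    (ne_of_gt (EReal.bot_lt_zero.trans_le h4))

lemma GamW₀.pair_le_of_eq {q : ℝ≥0∞} {ω : GamW₀ μ E} {k : Lp ℝ q μ}
    (hk : toExt (k : X →ₘ[μ] ℝ) = GamW₀.ptNorm ω) (v : Sec μ E) (hv : ∀ᵐ x ∂μ, ‖v.1 x‖ ≤ 1) :
    ∀ᵐ x ∂μ, |GamW₀.pair v ω x| ≤ k x := by
  have hv' : ∀ᵐ x ∂μ, ‖(-v).1 x‖ ≤ 1 := by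
    filter_upwards [hv] with x hx
    have : (-v).1 x = -(v.1 x) := rfl
    rwa [this, norm_neg]
  have hneg : GamW₀.pair (-v) ω =ᵐ[μ] fun x => -GamW₀.pair v ω x := by
    obtain ⟨ω, rfl⟩ := Submodule.mkQ_surjective _ ω
    filter_upwards [AEEqFun.coeFn_mk _ (ω.2 (-v)), AEEqFun.coeFn_mk _ (ω.2 v)] with x h1 h2
    exact h1.trans ((map_neg (ω.1 x) (v.1 x)).trans (congrArg Neg.neg h2.symm))
  filter_upwards [GamW₀.le_ptNorm ω v hv, GamW₀.le_ptNorm ω (-v) hv', hneg,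
    coeFn_toExt (k : X →ₘ[μ] ℝ)] with x h1 h2 h3 h4
  rw [← hk, h4, EReal.coe_le_coe_iff] at h1 h2
  rw [h3] at h2
  exact abs_le'.2 ⟨h1, h2⟩

variable (μ E) in
/-- `Γ_q(E'_{w*})`: the elements of `Γ₀(E'_{w*})` whose pointwise norm belongs to `L^q(μ)`. -/
def GamW (q : ℝ≥0∞) : Submodule (Linf μ) (GamW₀ μ E) where
  carrier := {ω | ∃ k : Lp ℝ q μ, toExt (k : X →ₘ[μ] ℝ) = GamW₀.ptNorm ω}
  add_mem' := by
    rintro ω η ⟨k, hk⟩ ⟨l, hl⟩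
    refine GamW₀.exists_of_le _ _ ((Lp.memLp k).add (Lp.memLp l)) fun v hv => ?_
    rw [map_add]
    filter_upwards [GamW₀.pair_le_of_eq hk v hv, GamW₀.pair_le_of_eq hl v hv,
      AEEqFun.coeFn_add (GamW₀.pair v ω) (GamW₀.pair v η)] with x h1 h2 h3
    rw [h3]
    exact add_le_add (le_of_abs_le h1) (le_of_abs_le h2)
  zero_mem' := by
    refine GamW₀.exists_of_le _ _ (MemLp.zero (ε := ℝ)) fun v _ => ?_
    rw [map_zero]
    filter_upwards [(AEEqFun.coeFn_zero : ((0 : X →ₘ[μ] ℝ) : X → ℝ) =ᵐ[μ] 0)] with x hx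
    rw [hx]
  smul_mem' := by
    rintro f ω ⟨k, hk⟩
    refine GamW₀.exists_of_le _ _ ((Lp.memLp (f • k)).norm) fun v hv => ?_
    have hp : GamW₀.pair v (f • ω) =ᵐ[μ] fun x => (f : X →ₘ[μ] ℝ) x * GamW₀.pair v ω x := by
      obtain ⟨ω, rfl⟩ := Submodule.mkQ_surjective _ ω
      filter_upwards [AEEqFun.coeFn_mk _ (ω.2 v),
        AEEqFun.coeFn_mk _ ((WSec.mul (f : X →ₘ[μ] ℝ) ω).2 v)] with x h1 h2
      exact h2.trans (congrArg (fun t => (f : X →ₘ[μ] ℝ) x * t) h1.symm)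
    filter_upwards [GamW₀.pair_le_of_eq hk v hv, hp, coeFn_linf_smul f k] with x h1 h2 h3
    rw [h2, h3, norm_smul, Real.norm_eq_abs, Real.norm_eq_abs]
    calc _ ≤ |(f : X →ₘ[μ] ℝ) x * GamW₀.pair v ω x| := le_abs_self _
      _ = |(f : X →ₘ[μ] ℝ) x| * |GamW₀.pair v ω x| := abs_mul _ _
      _ ≤ _ := mul_le_mul_of_nonneg_left (h1.trans (le_abs_self _)) (abs_nonneg _)

/-- The pointwise norm on `Γ_q(E'_{w*})`, with values in `L^q(μ)`. -/
def GamW.ptNorm {q : ℝ≥0∞} (ω : GamW μ E q) : Lp ℝ q μ := ω.2.choose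

lemma GamW.toExt_ptNorm {q : ℝ≥0∞} (ω : GamW μ E q) :
    toExt (GamW.ptNorm ω : X →ₘ[μ] ℝ) = GamW₀.ptNorm (ω : GamW₀ μ E) := ω.2.choose_spec

end Bundles

end BundleDual

end

/-!
The map `I` sends `ω` to the functional `v ↦ ⟨ω(·), v(·)⟩`. Hölder's inequality puts it into the
module dual, and exhausting a section by its restrictions to sets on which it is bounded and
integrable (`Sec.exists_cutoff`) gives injectivity and the equality of the two pointwise norms. The
content is in two facts about an element `T` of the module dual.

First, the pointwise norm of `T` is in `L^q`. The images under `T` of the unit ball are closed under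
maxima, by gluing along measurable sets, so `|T|` is the limit of an increasing sequence `T w_n`.
Testing `T` against `a ^ (q - 1) w_n`, where `a` is a truncation of `T w_n`, bounds `∫ a ^ q` by the
`q`-th power of the norm of `T` (`ModuleDual.lintegral_truncation_le`), and monotone convergence
does the rest. The bound of `‖|T|‖_q` by the norm of `T` also gives completeness: a Cauchy sequence
converges pointwise, and its limit is a limit in norm.

Second, `T` is represented by a field of functionals. As `B` may be nonseparable, this rests on a
linear lifting of `L^∞(μ)` (`exists_linear_lifting`): positive contractive functionals `φ x` on
`L^∞(μ)` such that `x ↦ φ x f` represents `f`. With `|T v| ≤ g |v|` and `h = 1 + |g|`, the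
functional `v ↦ φ x (T v / h)` on the bounded elements of `Γ_p(E)` is dominated by `v ↦ φ x (|v|)`,
and so extends to `L^∞(μ; B)` by Hahn-Banach; `ω x` is `h x` times the restriction of the extension
to constant functions. Almost every `x` is a Lebesgue point of `v`, in the sense that `φ x (|v - v
x|) = 0` (`ae_lifting_norm_sub_eq_zero`), whence `ω x (v x) = T v x`. The functional `ω x` is
defined on all of `B`, so that no selection of sections of `E` is needed.

The lifting is obtained from Zorn's lemma on liftings of sub-`σ`-algebras whose point functionals
are already defined on all of `L^∞(μ)`. One more set `A` is adjoined by conditioning the functionals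
on `A` at the points of `A` and on `Aᶜ` at the others (`PartialLift.exists_extend`). Chains of
countable cofinality are bounded with the help of Lévy's martingale convergence theorem; in the
other chains the union of the `σ`-algebras is a `σ`-algebra.
-/

noncomputable section

namespace BundleDual

/-! ### Linear liftings of bounded measurable functions -/

section Lifting

open Topology

variable {X : Type*} {m m0 : MeasurableSpace X} {μ : Measure X}

/-- The indicator function of a set, with values `0` and `1` in `ℝ`. -/
abbrev ind (S : Set X) : X → ℝ := S.indicator fun _ => 1

lemma ind_of_mem {S : Set X} {x : X} (h : x ∈ S) : ind S x = 1 := Set.indicator_of_mem h _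

lemma ind_of_notMem {S : Set X} {x : X} (h : x ∉ S) : ind S x = 0 := Set.indicator_of_notMem h _

lemma memLp_ind {S : Set X} (hS : MeasurableSet S) : MemLp (ind S) ∞ μ :=
  (memLp_top_const (1 : ℝ)).indicator hS

lemma stronglyMeasurable_ind {S : Set X} (hS : MeasurableSet[m] S) :
    StronglyMeasurable[m] (ind S) :=
  stronglyMeasurable_const.indicator hS

lemma ind_nonneg (S : Set X) (x : X) : 0 ≤ ind S x :=
  Set.indicator_nonneg (fun _ _ => zero_le_one) x

lemma exists_bound {β : Type*} [NormedAddCommGroup β] {f : X → β} (hf : MemLp f ∞ μ) :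
    ∃ C : ℝ, 0 ≤ C ∧ ∀ᵐ x ∂μ, ‖f x‖ ≤ C := by
  refine ⟨(eLpNorm f ∞ μ).toReal, ENNReal.toReal_nonneg, ?_⟩
  have h : eLpNorm f ∞ μ ≠ ∞ := hf.2.ne
  rw [eLpNorm_exponent_top] at h ⊢
  filter_upwards [ae_le_eLpNormEssSup (f := f) (μ := μ)] with x hx
  have := ENNReal.toReal_mono h hx
  simpa using this

variable (μ) in
/-- A positive linear functional of norm at most `1` on `L^∞(μ)`, encoded as a function on all of
`X → ℝ` that is only constrained on essentially bounded functions. -/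
structure IsSubstate (φ : (X → ℝ) → ℝ) : Prop where
  congr : ∀ {f g : X → ℝ}, f =ᵐ[μ] g → φ f = φ g
  add : ∀ {f g : X → ℝ}, MemLp f ∞ μ → MemLp g ∞ μ → φ (fun x => f x + g x) = φ f + φ g
  smul : ∀ (c : ℝ) {f : X → ℝ}, MemLp f ∞ μ → φ (fun x => c * f x) = c * φ f
  nonneg : ∀ {f : X → ℝ}, MemLp f ∞ μ → (∀ᵐ x ∂μ, 0 ≤ f x) → 0 ≤ φ f
  one_le : φ (fun _ => 1) ≤ 1

namespace IsSubstate

variable {φ : (X → ℝ) → ℝ}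

lemma sub (h : IsSubstate μ φ) {f g : X → ℝ} (hf : MemLp f ∞ μ) (hg : MemLp g ∞ μ) :
    φ (fun x => f x - g x) = φ f - φ g := by
  have h1 := h.add hf (hg.const_mul (-1))
  rw [h.smul (-1) hg] at h1
  simpa [sub_eq_add_neg] using h1

lemma mono (h : IsSubstate μ φ) {f g : X → ℝ} (hf : MemLp f ∞ μ) (hg : MemLp g ∞ μ)
    (hfg : ∀ᵐ x ∂μ, f x ≤ g x) : φ f ≤ φ g := by
  have := h.nonneg (hg.sub hf) (by filter_upwards [hfg] with x hx; simpa using hx)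
  have h2 := h.sub hg hf
  have h3 : φ (g - f) = φ (fun x => g x - f x) := rfl
  linarith

lemma const_le (h : IsSubstate μ φ) {c : ℝ} (hc : 0 ≤ c) : φ (fun _ => c) ≤ c := by
  have := h.smul c (memLp_top_const (1 : ℝ))
  simp only [mul_one] at this
  rw [this]
  exact mul_le_of_le_one_right hc h.one_le

lemma le_of_le (h : IsSubstate μ φ) {f : X → ℝ} (hf : MemLp f ∞ μ) {c : ℝ} (hc : 0 ≤ c)
    (hfc : ∀ᵐ x ∂μ, f x ≤ c) : φ f ≤ c :=
  (h.mono hf (memLp_top_const c) hfc).trans (h.const_le hc)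

lemma abs_le (h : IsSubstate μ φ) {f : X → ℝ} (hf : MemLp f ∞ μ) {c : ℝ} (hc : 0 ≤ c)
    (hfc : ∀ᵐ x ∂μ, |f x| ≤ c) : |φ f| ≤ c := by
  refine abs_le'.2 ⟨h.le_of_le hf hc ?_, ?_⟩
  · filter_upwards [hfc] with x hx using (le_abs_self _).trans hx
  · have h1 := h.smul (-1) hf
    rw [← neg_one_mul, ← h1]
    refine h.le_of_le (hf.const_mul (-1)) hc ?_
    filter_upwards [hfc] with x hx
    rw [neg_one_mul]
    exact (neg_le_abs _).trans hx

end IsSubstate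

/-- Ultrafilter limits of positive contractive functionals are again such functionals. -/
lemma exists_ultralimit {ι : Type*} (U : Ultrafilter ι) (φ : ι → (X → ℝ) → ℝ)
    (h : ∀ i, IsSubstate μ (φ i)) :
    ∃ ψ, IsSubstate μ ψ ∧ ∀ f, MemLp f ∞ μ → Tendsto (fun i => φ i f) U (𝓝 (ψ f)) := by
  have key : ∀ f, MemLp f ∞ μ →
      Tendsto (fun i => φ i f) U (𝓝 (limUnder (U : Filter ι) fun i => φ i f)) := by
    intro f hf
    obtain ⟨C, hC, hfC⟩ := exists_bound hf
    refine tendsto_nhds_limUnder ?_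
    have hmem : (U.map fun i => φ i f : Filter ℝ) ≤ 𝓟 (Set.Icc (-C) C) := by
      rw [le_principal_iff]
      refine mem_map.2 (univ_mem' fun i => ?_)
      exact _root_.abs_le.1 ((h i).abs_le hf hC hfC)
    obtain ⟨a, -, ha⟩ := isCompact_Icc.ultrafilter_le_nhds (U.map fun i => φ i f) hmem
    exact ⟨a, ha⟩
  refine ⟨fun f => limUnder (U : Filter ι) fun i => φ i f, ⟨?_, ?_, ?_, ?_, ?_⟩, key⟩
  · intro f g hfg
    simp only [fun i => (h i).congr hfg]
  · intro f g hf hg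
    refine tendsto_nhds_unique (key _ (hf.add hg)) (((key f hf).add (key g hg)).congr fun i => ?_)
    exact ((h i).add hf hg).symm
  · intro c f hf
    refine tendsto_nhds_unique (key _ (hf.const_mul c)) (((key f hf).const_mul c).congr fun i => ?_)
    exact ((h i).smul c hf).symm
  · intro f hf h0
    exact ge_of_tendsto' (key f hf) fun i => (h i).nonneg hf h0
  · exact le_of_tendsto' (key _ (memLp_top_const _)) fun i => (h i).one_le

/-- If point functionals reproduce the indicators of the sets of `m`, then they reproduce all
bounded `m`-measurable functions: on `{r ≤ f}` one has `f ≥ r` up to the complementary set. -/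
lemma ae_eq_of_ae_eq_ind (hm : m ≤ m0) {φ : X → (X → ℝ) → ℝ}
    (hφ : ∀ x, IsSubstate μ (φ x))
    (hS : ∀ S, MeasurableSet[m] S → ∀ᵐ x ∂μ, φ x (ind S) = ind S x)
    {f : X → ℝ} (hf : MemLp f ∞ μ) (hfm : Measurable[m] f) : ∀ᵐ x ∂μ, φ x f = f x := by
  have key : ∀ f : X → ℝ, MemLp f ∞ μ → Measurable[m] f → ∀ᵐ x ∂μ, f x ≤ φ x f := by
    intro f hf hfm
    obtain ⟨C, hC, hfC⟩ := exists_bound hf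
    have hmeas : ∀ r : ℚ, MeasurableSet[m] {x | (r : ℝ) ≤ f x} := fun r =>
      hfm measurableSet_Ici
    have h1 : ∀ᵐ x ∂μ, ∀ r : ℚ, (φ x (ind {x | (r : ℝ) ≤ f x}) = ind {x | (r : ℝ) ≤ f x} x ∧
        φ x (ind {x | (r : ℝ) ≤ f x}ᶜ) = ind {x | (r : ℝ) ≤ f x}ᶜ x) :=
      ae_all_iff.2 fun r => (hS _ (hmeas r)).and (hS _ (@MeasurableSet.compl _ _ m (hmeas r)))
    filter_upwards [h1] with x hx
    refine le_of_forall_rat_lt_imp_le fun r hr => ?_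
    obtain ⟨h2, h3⟩ := hx r
    have hm0 := hm _ (hmeas r)
    have e2 : ind {x | (r : ℝ) ≤ f x} x = 1 := ind_of_mem (S := {x | (r : ℝ) ≤ f x}) hr.le
    have e3 : ind {x | (r : ℝ) ≤ f x}ᶜ x = 0 := ind_of_notMem fun h => h hr.le
    rw [e2] at h2
    rw [e3] at h3
    have hA : MemLp (fun y => (r : ℝ) * ind {x | (r : ℝ) ≤ f x} y) ∞ μ :=
      (memLp_ind hm0).const_mul _
    have hB : MemLp (fun y => (-C) * ind {x | (r : ℝ) ≤ f x}ᶜ y) ∞ μ :=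
      (memLp_ind hm0.compl).const_mul _
    have h4 := (hφ x).mono (hA.add hB) hf (by
      filter_upwards [hfC] with y hy
      by_cases hyr : (r : ℝ) ≤ f y
      · simp [hyr]
      · simpa [hyr] using (_root_.abs_le.1 hy).1)
    have h5 := (hφ x).add hA hB
    rw [(hφ x).smul _ (memLp_ind hm0), (hφ x).smul _ (memLp_ind hm0.compl), h2, h3] at h5
    have h6 := h5.symm.le.trans h4
    linarith
  filter_upwards [key f hf hfm, key (fun x => (-1) * f x) (hf.const_mul (-1))
    (hfm.const_mul (-1))] with x h1 h2
  rw [(hφ x).smul _ hf] at h2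
  linarith

variable (μ) in
/-- A linear lifting of `L^∞` of a sub-`σ`-algebra `alg`: a family of point functionals, defined on
all of `L^∞(μ)`, that reproduce the indicator of each set of `alg` almost everywhere. -/
structure PartialLift where
  /-- the sub-`σ`-algebra on which the functionals reproduce functions -/
  alg : MeasurableSpace X
  alg_le : alg ≤ m0
  /-- the point functionals -/
  toFun : X → (X → ℝ) → ℝ
  isSubstate : ∀ x, IsSubstate μ (toFun x)
  ae_eq : ∀ S, MeasurableSet[alg] S → ∀ᵐ x ∂μ, toFun x (ind S) = ind S x

/-- Extension of partial liftings: the `σ`-algebra grows and the values on the old one are kept at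
every point. -/
instance : Preorder (PartialLift μ) where
  le P Q := P.alg ≤ Q.alg ∧
    ∀ S, MeasurableSet[P.alg] S → ∀ x, Q.toFun x (ind S) = P.toFun x (ind S)
  le_refl P := ⟨le_refl _, fun _ _ _ => rfl⟩
  le_trans P Q R h1 h2 := ⟨h1.1.trans h2.1, fun S hS x =>
    (h2.2 S (h1.1 S hS) x).trans (h1.2 S hS x)⟩

section OneStep

variable (μ m) in
/-- The conditional expectation of `f` given `m` for the measure `μ` conditioned on `A`, computed
with respect to `μ`. It vanishes where the conditional probability of `A` does, as `a / 0 = 0`. -/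
def condOn (A : Set X) (f : X → ℝ) : X → ℝ := fun x =>
  (μ[A.indicator f | m]) x / (μ[ind A | m]) x

variable {A : Set X}

lemma condOn_congr_ae {f g : X → ℝ} (h : f =ᵐ[μ] g) : condOn m μ A f =ᵐ[μ] condOn m μ A g := by
  have h1 : A.indicator f =ᵐ[μ] A.indicator g := by
    filter_upwards [h] with x hx
    simp only [Set.indicator, hx]
  filter_upwards [condExp_congr_ae (m := m) h1] with x hx
  rw [condOn, condOn, hx]

lemma condExp_ind_nonneg : ∀ᵐ x ∂μ, 0 ≤ (μ[ind A | m]) x :=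
  condExp_nonneg (ae_of_all _ (ind_nonneg A))

lemma condOn_ind_congr {S T : Set X} (h : A ∩ S = A ∩ T) :
    condOn m μ A (ind S) = condOn m μ A (ind T) := by
  funext x
  simp only [condOn, ind, Set.indicator_indicator, h]

lemma condOn_smul (c : ℝ) (f : X → ℝ) :
    condOn m μ A (fun x => c * f x) =ᵐ[μ] fun x => c * condOn m μ A f x := by
  have h1 : A.indicator (fun x => c * f x) = c • A.indicator f :=
    Set.indicator_const_smul A c f
  filter_upwards [condExp_smul (μ := μ) c (A.indicator f) m] with x hx
  rw [condOn, h1, hx, Pi.smul_apply, smul_eq_mul, mul_div_assoc, condOn]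

lemma condOn_nonneg {f : X → ℝ} (h : ∀ᵐ x ∂μ, 0 ≤ f x) : ∀ᵐ x ∂μ, 0 ≤ condOn m μ A f x := by
  have h1 : 0 ≤ᵐ[μ] A.indicator f := by
    filter_upwards [h] with x hx
    exact Set.indicator_apply_nonneg fun _ => hx
  filter_upwards [condExp_nonneg (m := m) h1, condExp_ind_nonneg (m := m) (A := A)] with x h2 h3
  exact div_nonneg h2 h3

variable [IsFiniteMeasure μ]

lemma integrable_indicator (hA : MeasurableSet A) {f : X → ℝ} (hf : MemLp f ∞ μ) :
    Integrable (A.indicator f) μ :=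
  ((hf.mono_exponent le_top).integrable le_rfl).indicator hA

lemma condOn_add (hA : MeasurableSet A) {f g : X → ℝ} (hf : MemLp f ∞ μ) (hg : MemLp g ∞ μ) :
    condOn m μ A (fun x => f x + g x) =ᵐ[μ] fun x => condOn m μ A f x + condOn m μ A g x := by
  have h1 : A.indicator (fun x => f x + g x) = A.indicator f + A.indicator g :=
    Set.indicator_add' _ _ _
  filter_upwards [condExp_add (m := m) (integrable_indicator hA hf) (integrable_indicator hA hg)]
    with x hx
  rw [condOn, h1, hx, Pi.add_apply, add_div, condOn, condOn]

omit [IsFiniteMeasure μ] in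
lemma condOn_one_le (x : X) : condOn m μ A (fun _ => 1) x ≤ 1 := div_self_le_one _

lemma memLp_condOn (hm : m ≤ m0) (hA : MeasurableSet A) {f : X → ℝ} (hf : MemLp f ∞ μ) :
    MemLp (condOn m μ A f) ∞ μ := by
  obtain ⟨C, hC, hfC⟩ := exists_bound hf
  have key : ∀ g : X → ℝ, MemLp g ∞ μ → (∀ᵐ x ∂μ, g x ≤ C) → ∀ᵐ x ∂μ, condOn m μ A g x ≤ C := by
    intro g hg hgC
    have h1 : ∀ᵐ x ∂μ, 0 ≤ C + (-1) * g x := by filter_upwards [hgC] with x hx; linarith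
    have hCm : MemLp (fun _ : X => C) ∞ μ := memLp_top_const C
    filter_upwards [condOn_nonneg (m := m) (A := A) h1,
      condOn_add (m := m) hA hCm (hg.const_mul (-1)),
      condOn_smul (μ := μ) (m := m) (A := A) (-1) g,
      condOn_smul (μ := μ) (m := m) (A := A) C (fun _ => 1)] with x h2 h3 h4 h5
    rw [h3, h4] at h2
    simp only [mul_one] at h5
    have := mul_le_of_le_one_right hC (condOn_one_le (μ := μ) (m := m) (A := A) x)
    rw [h5] at h2
    linarith
  refine memLp_top_of_bound ?_ C ?_
  · exact (((stronglyMeasurable_condExp.mono hm).measurable).div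
      ((stronglyMeasurable_condExp.mono hm).measurable)).aestronglyMeasurable
  · filter_upwards [key f hf (by filter_upwards [hfC] with x hx using (le_abs_self _).trans hx),
      key (fun x => (-1) * f x) (hf.const_mul (-1)) (by
        filter_upwards [hfC] with x hx
        rw [neg_one_mul]
        exact (neg_le_abs _).trans hx), condOn_smul (μ := μ) (m := m) (A := A) (-1) f]
      with x h1 h2 h3
    rw [h3] at h2
    exact abs_le'.2 ⟨h1, by linarith⟩

lemma IsSubstate.condOn {φ : (X → ℝ) → ℝ} (h : IsSubstate μ φ) (hm : m ≤ m0)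
    (hA : MeasurableSet A) : IsSubstate μ fun f => φ (condOn m μ A f) where
  congr hfg := h.congr (condOn_congr_ae hfg)
  add hf hg := (h.congr (condOn_add hA hf hg)).trans
    (h.add (memLp_condOn hm hA hf) (memLp_condOn hm hA hg))
  smul c f hf := (h.congr (condOn_smul c f)).trans (h.smul c (memLp_condOn hm hA hf))
  nonneg hf h0 := h.nonneg (memLp_condOn hm hA hf) (condOn_nonneg h0)
  one_le := h.le_of_le (memLp_condOn hm hA (memLp_top_const 1)) zero_le_one
    (ae_of_all _ condOn_one_le)

/-- Conditioning on `A` does not change the indicator of a set of `m`, up to the set where the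
conditional probability of `A` vanishes. -/
lemma condOn_ind (hA : MeasurableSet A) {S : Set X} (hS : MeasurableSet[m] S) :
    condOn m μ A (ind S) =ᵐ[μ] ind (S ∩ {x | (μ[ind A | m]) x = 0}ᶜ) := by
  have h1 : A.indicator (ind S) = S.indicator (ind A) := by
    ext x
    by_cases hx : x ∈ A <;> by_cases hx' : x ∈ S <;> simp [hx, hx']
  filter_upwards [condExp_indicator (m := m)
    (integrable_indicator hA (memLp_top_const (1 : ℝ)) : Integrable (ind A) μ) hS] with x hx
  rw [BundleDual.condOn, h1, hx]
  by_cases hxS : x ∈ S <;> by_cases hx0 : (μ[ind A | m]) x = 0 <;> simp [hxS, hx0]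

/-- The conditional probability of `A` is nonzero at almost every point of `A`. -/
lemma ae_condExp_ind_ne_zero (hA : MeasurableSet A) (hm : m ≤ m0) :
    ∀ᵐ x ∂μ, x ∈ A → (μ[ind A | m]) x ≠ 0 := by
  have hZ : MeasurableSet[m] {x | (μ[ind A | m]) x = 0} :=
    (stronglyMeasurable_condExp (μ := μ) (m := m) (f := ind A)).measurable
      (measurableSet_singleton 0)
  have hint : Integrable (ind A) μ := integrable_indicator hA (memLp_top_const (1 : ℝ))
  have h1 := setIntegral_condExp hm hint hZ
  rw [setIntegral_congr_fun (g := fun _ => (0 : ℝ)) (hm _ hZ) (fun x hx => hx), integral_zero,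
    show ind A = A.indicator (fun _ => (1 : ℝ)) from rfl, setIntegral_indicator hA,
    setIntegral_const, smul_eq_mul, mul_one] at h1
  have h2 : μ ({x | (μ[ind A | m]) x = 0} ∩ A) = 0 := by
    have := (measureReal_eq_zero_iff (by finiteness)).1 h1.symm
    exact this
  have h3 := measure_eq_zero_iff_ae_notMem.1 h2
  filter_upwards [h3] with x hx hxA h0
  exact hx ⟨h0, hxA⟩

variable (m) in
/-- The `σ`-algebra generated by `m` and one more set `A`: the sets that agree on `A`, and on the
complement of `A`, with sets of `m`. -/
@[reducible]
def adjoin (A : Set X) : MeasurableSpace X where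
  MeasurableSet' S := ∃ B C, MeasurableSet[m] B ∧ MeasurableSet[m] C ∧
    A ∩ S = A ∩ B ∧ Aᶜ ∩ S = Aᶜ ∩ C
  measurableSet_empty := ⟨∅, ∅, @MeasurableSet.empty _ m, @MeasurableSet.empty _ m, rfl, rfl⟩
  measurableSet_compl := by
    have aux : ∀ A S B : Set X, A ∩ S = A ∩ B → A ∩ Sᶜ = A ∩ Bᶜ := by
      intro A S B h
      rw [← Set.sdiff_eq, ← Set.sdiff_eq, ← Set.sdiff_inter_self_eq_sdiff, Set.inter_comm, h,
        Set.inter_comm, Set.sdiff_inter_self_eq_sdiff]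
    rintro S ⟨B, C, hB, hC, h1, h2⟩
    exact ⟨Bᶜ, Cᶜ, hB.compl, hC.compl, aux _ _ _ h1, aux _ _ _ h2⟩
  measurableSet_iUnion := by
    intro S hS
    choose B C hB hC h1 h2 using hS
    refine ⟨⋃ i, B i, ⋃ i, C i, MeasurableSet.iUnion hB, MeasurableSet.iUnion hC, ?_, ?_⟩
    · simp only [Set.inter_iUnion, h1]
    · simp only [Set.inter_iUnion, h2]

lemma adjoin_le (hm : m ≤ m0) (hA : MeasurableSet A) : adjoin m A ≤ m0 := by
  rintro S ⟨B, C, hB, hC, h1, h2⟩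
  rw [← Set.inter_union_compl S A, Set.inter_comm, h1, Set.inter_comm S, h2]
  exact (hA.inter (hm _ hB)).union (hA.compl.inter (hm _ hC))

lemma le_adjoin : m ≤ adjoin m A := fun S hS => ⟨S, S, hS, hS, rfl, rfl⟩

lemma measurableSet_adjoin_self : MeasurableSet[adjoin m A] A := by
  exact ⟨Set.univ, ∅, @MeasurableSet.univ _ m, @MeasurableSet.empty _ m, by simp, by simp⟩

/-- At a point whose functional does not see the set where the conditional probability of `A`
vanishes, conditioning on `A` keeps the value on the indicators of the sets of `m`. -/
lemma IsSubstate.condOn_ind_eq {φ : (X → ℝ) → ℝ} (h : IsSubstate μ φ) (hm : m ≤ m0)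
    (hA : MeasurableSet A) (h0 : φ (ind {x | (μ[ind A | m]) x = 0}) = 0) {S : Set X}
    (hS : MeasurableSet[m] S) : φ (BundleDual.condOn m μ A (ind S)) = φ (ind S) := by
  set Z := {x | (μ[ind A | m]) x = 0} with hZd
  have hZ : MeasurableSet Z := hm _
    ((stronglyMeasurable_condExp (μ := μ) (m := m) (f := ind A)).measurable
      (measurableSet_singleton 0))
  have hS' := hm _ hS
  rw [h.congr (condOn_ind hA hS)]
  refine le_antisymm (h.mono (memLp_ind (hS'.inter hZ.compl)) (memLp_ind hS')
    (ae_of_all _ fun x => ?_)) ?_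
  · exact Set.indicator_le_indicator_of_subset Set.inter_subset_left (fun _ => zero_le_one) x
  · have h3 : MemLp (fun x => ind (S ∩ Zᶜ) x + ind Z x) ∞ μ :=
      (memLp_ind (hS'.inter hZ.compl)).add (memLp_ind hZ)
    have h1 := h.mono (memLp_ind hS') h3 (ae_of_all _ fun x => by
        by_cases hxS : x ∈ S <;> by_cases hxZ : x ∈ Z <;> simp [hxS, hxZ])
    have h2 := h.add (memLp_ind (hS'.inter hZ.compl)) (memLp_ind hZ)
    rw [h0, add_zero] at h2
    exact h1.trans h2.le

open Classical in
/-- Every measurable set can be adjoined to the `σ`-algebra of a partial lifting: over the points of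
`A` the functionals are conditioned on `A`, over the other points on its complement. -/
lemma PartialLift.exists_extend (P : PartialLift μ) (hA : MeasurableSet A) :
    ∃ Q : PartialLift μ, P ≤ Q ∧ MeasurableSet[Q.alg] A := by
  let good (A : Set X) (x : X) : Prop := P.toFun x (ind {y | (μ[ind A | P.alg]) y = 0}) = 0
  have hgood : ∀ A : Set X, MeasurableSet A → ∀ᵐ x ∂μ, x ∈ A → good A x := by
    intro A hA
    have hZ : MeasurableSet[P.alg] {x | (μ[ind A | P.alg]) x = 0} :=
      (stronglyMeasurable_condExp (μ := μ) (m := P.alg) (f := ind A)).measurable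
        (measurableSet_singleton 0)
    filter_upwards [P.ae_eq _ hZ, ae_condExp_ind_ne_zero hA P.alg_le] with x h1 h2 hx
    exact h1.trans (ind_of_notMem (S := {x | (μ[ind A | P.alg]) x = 0}) (h2 hx))
  -- The points that are not good form a null set; there the old functional is kept.
  let ψ : X → (X → ℝ) → ℝ := fun x =>
    if x ∈ A ∧ good A x then fun f => P.toFun x (condOn P.alg μ A f)
    else if x ∈ Aᶜ ∧ good Aᶜ x then fun f => P.toFun x (condOn P.alg μ Aᶜ f)
    else P.toFun x
  have hψ : ∀ x, IsSubstate μ (ψ x) := by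
    intro x
    simp only [ψ]
    split_ifs
    · exact (P.isSubstate x).condOn P.alg_le hA
    · exact (P.isSubstate x).condOn P.alg_le hA.compl
    · exact P.isSubstate x
  have hext : ∀ S, MeasurableSet[P.alg] S → ∀ x, ψ x (ind S) = P.toFun x (ind S) := by
    intro S hS x
    simp only [ψ]
    split_ifs with h1 h2
    · exact (P.isSubstate x).condOn_ind_eq P.alg_le hA h1.2 hS
    · exact (P.isSubstate x).condOn_ind_eq P.alg_le hA.compl h2.2 hS
    · rfl
  refine ⟨⟨adjoin P.alg A, adjoin_le P.alg_le hA, ψ, hψ, ?_⟩, ⟨le_adjoin, hext⟩,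
    measurableSet_adjoin_self⟩
  rintro S ⟨B, C, hB, hC, h1, h2⟩
  filter_upwards [P.ae_eq B hB, P.ae_eq C hC, hgood A hA, hgood Aᶜ hA.compl] with x h3 h4 h5 h6
  by_cases hx : x ∈ A
  · have h7 : ψ x (ind S) = ψ x (ind B) := by
      simp only [ψ]
      rw [if_pos ⟨hx, h5 hx⟩]
      exact congrArg (P.toFun x) (condOn_ind_congr h1)
    rw [h7, hext B hB, h3]
    have h8 : x ∈ S ↔ x ∈ B := by simpa [hx] using Set.ext_iff.1 h1 x
    simp only [ind, Set.indicator_apply, h8]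
  · have h7 : ψ x (ind S) = ψ x (ind C) := by
      simp only [ψ]
      rw [if_neg fun h => hx h.1, if_pos ⟨hx, h6 hx⟩]
      exact congrArg (P.toFun x) (condOn_ind_congr h2)
    rw [h7, hext C hC, h4]
    have h8 : x ∈ S ↔ x ∈ C := by simpa [hx] using Set.ext_iff.1 h2 x
    simp only [ind, Set.indicator_apply, h8]

end OneStep

section Chains

variable [IsFiniteMeasure μ]

omit [IsFiniteMeasure μ] in
lemma memLp_condExp (hm : m ≤ m0) {f : X → ℝ} (hf : MemLp f ∞ μ) :
    MemLp (μ[f | m]) ∞ μ := by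
  obtain ⟨C, hC, hfC⟩ := exists_bound hf
  exact memLp_top_of_bound (stronglyMeasurable_condExp.mono hm).aestronglyMeasurable C
    (ae_bdd_abs_condExp_of_ae_bdd_abs hfC)

lemma IsSubstate.condExp {φ : (X → ℝ) → ℝ} (h : IsSubstate μ φ)
    (hm : m ≤ m0) : IsSubstate μ fun f => φ (μ[f | m]) where
  congr hfg := h.congr (condExp_congr_ae hfg)
  add hf hg := (h.congr (condExp_add ((hf.mono_exponent le_top).integrable le_rfl)
    ((hg.mono_exponent le_top).integrable le_rfl) m)).trans
    (h.add (memLp_condExp hm hf) (memLp_condExp hm hg))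
  smul c f hf := (h.congr (condExp_smul c f m)).trans (h.smul c (memLp_condExp hm hf))
  nonneg hf h0 := h.nonneg (memLp_condExp hm hf) (condExp_nonneg h0)
  one_le := by
    rw [condExp_const hm (1 : ℝ)]
    exact h.one_le

/-- An increasing sequence of partial liftings has an upper bound: the point functionals
`f ↦ lim_U P_n(E[f | m_n])`, which reproduce functions by Lévy's convergence theorem. -/
lemma PartialLift.exists_upper_bound_seq (P : ℕ → PartialLift μ) (hP : Monotone P) :
    ∃ Q, ∀ n, P n ≤ Q := by
  let ℱ : Filtration ℕ m0 := ⟨fun n => (P n).alg, fun i j hij => (hP hij).1, fun n => (P n).alg_le⟩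
  choose ψ hψ hlim using fun x => exists_ultralimit (μ := μ) (hyperfilter ℕ)
    (fun n f => (P n).toFun x (μ[f | (P n).alg]))
    (fun n => ((P n).isSubstate x).condExp (P n).alg_le)
  have hU : (hyperfilter ℕ : Filter ℕ) ≤ atTop := Nat.hyperfilter_le_atTop
  have hle : (⨆ n, ℱ n) ≤ m0 := iSup_le fun n => (P n).alg_le
  refine ⟨⟨⨆ n, ℱ n, hle, ψ, hψ, ?_⟩, fun n => ⟨le_iSup (fun n => ℱ n) n, ?_⟩⟩
  · intro S hS
    have hmem : MemLp (ind S) ∞ μ := memLp_ind (hle _ hS)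
    have h1 : ∀ᵐ x ∂μ, ∀ n, (P n).toFun x (μ[ind S | (P n).alg]) = (μ[ind S | (P n).alg]) x :=
      ae_all_iff.2 fun n => ae_eq_of_ae_eq_ind (P n).alg_le (P n).isSubstate (P n).ae_eq
        (memLp_condExp (P n).alg_le hmem) stronglyMeasurable_condExp.measurable
    have h2 : (μ[ind S | ⨆ n, ℱ n]) = ind S := condExp_of_stronglyMeasurable hle
      (stronglyMeasurable_ind hS)
      ((hmem.mono_exponent le_top).integrable le_rfl)
    filter_upwards [h1, tendsto_ae_condExp (ℱ := ℱ) (μ := μ) (ind S)] with x h3 h4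
    rw [h2] at h4
    refine tendsto_nhds_unique (hlim x (ind S) hmem) ?_
    exact (h4.mono_left hU).congr fun n => (h3 n).symm
  · intro S hS x
    have hmem : MemLp (ind S) ∞ μ := memLp_ind ((P n).alg_le _ hS)
    refine tendsto_nhds_unique (hlim x (ind S) hmem) (tendsto_const_nhds.congr' ?_)
    refine hU ((eventually_ge_atTop n).mono fun k hk => ?_)
    have h2 : (μ[ind S | (P k).alg]) = ind S := condExp_of_stronglyMeasurable (P k).alg_le
      (stronglyMeasurable_ind ((hP hk).1 _ hS))
      ((hmem.mono_exponent le_top).integrable le_rfl)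
    change _ = (P k).toFun x (μ[ind S | (P k).alg])
    rw [h2, (hP hk).2 S hS]

omit [IsFiniteMeasure μ] in
/-- A nonempty chain without a countable cofinal subset has an upper bound: the union of its
`σ`-algebras is a `σ`-algebra. -/
lemma PartialLift.exists_upper_bound_of_not_cofinal (c : Set (PartialLift μ))
    (hc : IsChain (· ≤ ·) c) (hne : c.Nonempty)
    (h : ∀ P : ℕ → PartialLift μ, (∀ n, P n ∈ c) → ∃ Q ∈ c, ∀ n, ¬ Q ≤ P n) :
    ∃ Q, ∀ P ∈ c, P ≤ Q := by
  have h' : ∀ P : ℕ → PartialLift μ, (∀ n, P n ∈ c) → ∃ Q ∈ c, ∀ n, P n ≤ Q := by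
    intro P hP
    obtain ⟨Q, hQ, hPQ⟩ := h P hP
    exact ⟨Q, hQ, fun n => (hc.total hQ (hP n)).resolve_left (hPQ n)⟩
  have hcne : Nonempty c := hne.to_subtype
  have hdir : IsDirectedOrder c := ⟨fun a b => by
    rcases hc.total a.2 b.2 with h1 | h1
    · exact ⟨b, h1, le_refl b⟩
    · exact ⟨a, le_refl a, h1⟩⟩
  let m : MeasurableSpace X :=
    { MeasurableSet' := fun S => ∃ P ∈ c, MeasurableSet[P.alg] S
      measurableSet_empty := ⟨_, hne.some_mem, @MeasurableSet.empty _ hne.some.alg⟩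
      measurableSet_compl := by
        rintro S ⟨P, hP, hS⟩
        exact ⟨P, hP, @MeasurableSet.compl _ _ P.alg hS⟩
      measurableSet_iUnion := by
        intro S hS
        choose P hP hS using hS
        obtain ⟨Q, hQ, hPQ⟩ := h' P hP
        exact ⟨Q, hQ, @MeasurableSet.iUnion _ _ Q.alg _ _ fun n => (hPQ n).1 _ (hS n)⟩ }
  have hm : m ≤ m0 := by
    rintro S ⟨P, hP, hS⟩
    exact P.alg_le _ hS
  obtain ⟨U, hU⟩ := Ultrafilter.exists_le (atTop : Filter c)
  choose ψ hψ hlim using fun x => exists_ultralimit (μ := μ) U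
    (fun P : c => P.1.toFun x) (fun P => P.1.isSubstate x)
  have hext : ∀ P : c, ∀ S, MeasurableSet[P.1.alg] S → ∀ x, ψ x (ind S) = P.1.toFun x (ind S) := by
    intro P S hS x
    refine tendsto_nhds_unique (hlim x (ind S) (memLp_ind (P.1.alg_le _ hS)))
      (tendsto_const_nhds.congr' ?_)
    refine hU ((eventually_ge_atTop P).mono fun Q hQ => ?_)
    have hQ' : P.1 ≤ Q.1 := hQ
    exact (hQ'.2 S hS x).symm
  refine ⟨⟨m, hm, ψ, hψ, ?_⟩, fun P hP => ⟨fun S hS => ⟨P, hP, hS⟩, hext ⟨P, hP⟩⟩⟩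
  rintro S ⟨P, hP, hS⟩
  filter_upwards [P.ae_eq S hS] with x hx
  rw [hext ⟨P, hP⟩ S hS, hx]

instance : Nonempty (PartialLift μ) := by
  refine ⟨⟨⊥, bot_le, fun _ f => ⨍ x, f x ∂μ, fun _ => ⟨?_, ?_, ?_, ?_, ?_⟩, ?_⟩⟩
  · intro f g hfg
    exact average_congr hfg
  · intro f g hf hg
    simp only [average_eq, smul_eq_mul]
    rw [integral_add ((hf.mono_exponent le_top).integrable le_rfl)
      ((hg.mono_exponent le_top).integrable le_rfl), mul_add]
  · intro c f _
    simp only [average_eq, smul_eq_mul, integral_const_mul]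
    ring
  · intro f _ h0
    simp only [average_eq, smul_eq_mul]
    exact mul_nonneg (by positivity) (integral_nonneg_of_ae h0)
  · simp only [average_eq, integral_const, smul_eq_mul, mul_one]
    exact inv_mul_le_one
  · intro S hS
    rcases MeasurableSpace.measurableSet_bot_iff.1 hS with rfl | rfl
    · exact ae_of_all _ fun x => by simp
    · rcases eq_or_ne μ 0 with h | h
      · simp [h]
      · have : NeZero μ := ⟨h⟩
        exact ae_of_all _ fun x => by simp [ind]

lemma PartialLift.exists_upper_bound (c : Set (PartialLift μ)) (hc : IsChain (· ≤ ·) c) :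
    ∃ Q, ∀ P ∈ c, P ≤ Q := by
  rcases c.eq_empty_or_nonempty with rfl | hne
  · exact ⟨Classical.arbitrary _, fun P hP => hP.elim⟩
  by_cases h : ∀ P : ℕ → PartialLift μ, (∀ n, P n ∈ c) → ∃ Q ∈ c, ∀ n, ¬ Q ≤ P n
  · exact PartialLift.exists_upper_bound_of_not_cofinal c hc hne h
  · push Not at h
    obtain ⟨P, hP, hcof⟩ := h
    have hdir : Directed (· ≤ ·) P := fun i j => by
      rcases hc.total (hP i) (hP j) with h1 | h1
      · exact ⟨j, h1, le_refl _⟩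
      · exact ⟨i, le_refl _, h1⟩
    obtain ⟨Q, hQ⟩ := PartialLift.exists_upper_bound_seq (P ∘ Directed.sequence P hdir)
      (Directed.sequence_mono hdir)
    refine ⟨Q, fun R hR => ?_⟩
    obtain ⟨n, hn⟩ := hcof R hR
    exact (hn.trans (hdir.rel_sequence n)).trans (hQ _)

end Chains

/-- A linear lifting for a finite measure. -/
lemma exists_linear_lifting_of_finite (μ : Measure X) [IsFiniteMeasure μ] :
    ∃ φ : X → (X → ℝ) → ℝ, (∀ x, IsSubstate μ (φ x)) ∧
      ∀ f, MemLp f ∞ μ → ∀ᵐ x ∂μ, φ x f = f x := by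
  obtain ⟨P, hP⟩ := exists_maximal_of_chains_bounded (r := ((· ≤ ·) : PartialLift μ → _ → Prop))
    PartialLift.exists_upper_bound le_trans
  refine ⟨P.toFun, P.isSubstate, fun f hf => ?_⟩
  have hS : ∀ S, MeasurableSet S → ∀ᵐ x ∂μ, P.toFun x (ind S) = ind S x := by
    intro S hS
    obtain ⟨Q, hPQ, hSQ⟩ := P.exists_extend hS
    exact P.ae_eq S ((hP Q hPQ).1 S hSQ)
  have hae : f =ᵐ[μ] hf.1.mk f := hf.1.ae_eq_mk
  filter_upwards [hae, ae_eq_of_ae_eq_ind le_rfl P.isSubstate hS (hf.ae_eq hae)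
    hf.1.stronglyMeasurable_mk.measurable] with x h1 h2
  rw [(P.isSubstate x).congr hae, h2, h1]

/-- **Existence of a linear lifting** of `L^∞(μ)`: positive linear functionals `φ x` of norm at most
`1`, each depending only on a.e. classes, such that `x ↦ φ x f` is a representative of `f`. -/
theorem exists_linear_lifting (μ : Measure X) [SigmaFinite μ] :
    ∃ φ : X → (X → ℝ) → ℝ, (∀ x, IsSubstate μ (φ x)) ∧
      ∀ f, MemLp f ∞ μ → ∀ᵐ x ∂μ, φ x f = f x := by
  obtain ⟨φ, h1, h2⟩ := exists_linear_lifting_of_finite μ.toFinite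
  have hmem : ∀ {f : X → ℝ}, MemLp f ∞ μ → MemLp f ∞ μ.toFinite := by
    intro f hf
    obtain ⟨C, -, hC⟩ := exists_bound hf
    exact memLp_top_of_bound (hf.1.mono_ac (toFinite_absolutelyContinuous μ)) C
      (by rwa [ae_toFinite])
  refine ⟨φ, fun x => ⟨fun h => (h1 x).congr ?_, fun hf hg => (h1 x).add (hmem hf) (hmem hg),
    fun c f hf => (h1 x).smul c (hmem hf), fun hf h0 => (h1 x).nonneg (hmem hf) ?_,
    (h1 x).one_le⟩, fun f hf => ?_⟩
  · rwa [EventuallyEq, ae_toFinite]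
  · rwa [ae_toFinite]
  · rw [← ae_toFinite (μ := μ)]
    exact h2 f (hmem hf)

end Lifting

/-! ### The pointwise norm on the module dual, and its completeness -/

section DualNorm

open Topology

variable {X : Type*} [MeasurableSpace X] {μ : Measure X}

lemma toExt_le_toExt {f g : X →ₘ[μ] ℝ} : toExt f ≤ toExt g ↔ ∀ᵐ x ∂μ, f x ≤ g x := by
  rw [← AEEqFun.coeFn_le]
  refine eventually_congr ?_
  filter_upwards [coeFn_toExt f, coeFn_toExt g] with x h1 h2
  rw [h1, h2, EReal.coe_le_coe_iff]

lemma toExt_injective : Function.Injective (toExt : (X →ₘ[μ] ℝ) → X →ₘ[μ] EReal) := by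
  intro f g h
  refine AEEqFun.ext ?_
  filter_upwards [toExt_le_toExt.1 h.le, toExt_le_toExt.1 h.ge] with x h1 h2
  exact le_antisymm h1 h2

/-- The element of `L^∞(μ)` given by an essentially bounded function. -/
def Linf.of (f : X → ℝ) (hf : MemLp f ∞ μ) : Linf μ :=
  ⟨AEEqFun.mk f hf.1, hf.ae_eq (AEEqFun.coeFn_mk f hf.1).symm⟩

lemma Linf.coeFn_of {f : X → ℝ} (hf : MemLp f ∞ μ) : (Linf.of f hf : X →ₘ[μ] ℝ) =ᵐ[μ] f :=
  AEEqFun.coeFn_mk f hf.1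

variable {B : Type*} [NormedAddCommGroup B] [NormedSpace ℝ B] {E : BanachBundle X B}
  {p q : ℝ≥0∞}

lemma Linf.coeFn_of_smul {f : X → ℝ} (hf : MemLp f ∞ μ) (v : Lp B p μ) :
    (Linf.of f hf • v : Lp B p μ) =ᵐ[μ] fun x => f x • v x := by
  filter_upwards [coeFn_linf_smul (Linf.of f hf) v, Linf.coeFn_of hf] with x h1 h2
  rw [h1, h2]

/-- The values almost everywhere of an element of `Γ_p(E)`. -/
abbrev Gam.val (v : Gam μ E p) : X → B := ((v : Lp B p μ) : X → B)

lemma Gam.coeFn_of_smul {f : X → ℝ} (hf : MemLp f ∞ μ) (v : Gam μ E p) :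
    Gam.val (Linf.of f hf • v) =ᵐ[μ] fun x => f x • Gam.val v x :=
  Linf.coeFn_of_smul hf (v : Lp B p μ)

lemma Gam.coeFn_add (v w : Gam μ E p) :
    Gam.val (v + w) =ᵐ[μ] fun x => Gam.val v x + Gam.val w x :=
  Lp.coeFn_add (v : Lp B p μ) (w : Lp B p μ)

lemma Gam.coeFn_zero : Gam.val (0 : Gam μ E p) =ᵐ[μ] fun _ => 0 := Lp.coeFn_zero B p μ

lemma Gam.coeFn_ptNorm (v : Gam μ E p) : Gam.ptNorm v =ᵐ[μ] fun x => ‖Gam.val v x‖ :=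
  MemLp.coeFn_toLp _

lemma Gam.memLp (v : Gam μ E p) : MemLp (Gam.val v) p μ := Lp.memLp (v : Lp B p μ)

/-- The elements of the closed unit ball of `Γ_p(E)` for the pointwise norm. -/
abbrev Gam.InUnitBall (v : Gam μ E p) : Prop := ∀ᵐ x ∂μ, ‖Gam.val v x‖ ≤ 1

lemma Gam.inUnitBall_zero : Gam.InUnitBall (0 : Gam μ E p) := by
  filter_upwards [Gam.coeFn_zero (μ := μ) (E := E) (p := p)] with x hx
  rw [hx, norm_zero]
  exact zero_le_one

section

variable [Fact (1 ≤ p)]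

namespace ModuleDual

lemma coeFn_of_smul (T : ModuleDual μ (Gam μ E p)) {f : X → ℝ} (hf : MemLp f ∞ μ)
    (v : Gam μ E p) : T (Linf.of f hf • v) =ᵐ[μ] fun x => f x * T v x := by
  rw [map_smul]
  exact Linf.coeFn_of_smul hf (T v)

lemma coeFn_map_add (T : ModuleDual μ (Gam μ E p)) (v w : Gam μ E p) :
    T (v + w) =ᵐ[μ] fun x => T v x + T w x := by
  rw [map_add]
  exact Lp.coeFn_add (T v) (T w)

lemma coeFn_map_zero (T : ModuleDual μ (Gam μ E p)) :
    T (0 : Gam μ E p) =ᵐ[μ] fun _ => 0 := by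
  rw [map_zero]
  exact Lp.coeFn_zero ℝ 1 μ

/-- Continuous `L^∞`-linear maps are bounded: scaling by real constants is available through the
constant elements of `L^∞(μ)`. -/
lemma exists_norm_bound (T : ModuleDual μ (Gam μ E p)) :
    ∃ K : ℝ, 0 ≤ K ∧ ∀ v, ‖T v‖ ≤ K * ‖v‖ := by
  have hcont : ContinuousAt T 0 := T.continuous.continuousAt
  rw [Metric.continuousAt_iff] at hcont
  obtain ⟨δ, hδ, h⟩ := hcont 1 one_pos
  refine ⟨2 / δ, by positivity, fun v => ?_⟩
  rcases eq_or_ne v 0 with rfl | hv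
  · simp
  have hv' : 0 < ‖v‖ := norm_pos_iff.2 hv
  set c : ℝ := δ / (2 * ‖v‖) with hc
  have hc0 : 0 < c := by positivity
  have e1 : ((Linf.of (fun _ => c) (memLp_top_const (μ := μ) c) • v : Gam μ E p) : Lp B p μ) =
      c • (v : Lp B p μ) := by
    refine Lp.ext ((Gam.coeFn_of_smul _ v).trans ?_)
    exact (Lp.coeFn_smul c (v : Lp B p μ)).symm
  have e2 : T (Linf.of (fun _ => c) (memLp_top_const (μ := μ) c) • v) = c • T v := by
    refine Lp.ext ((coeFn_of_smul T _ v).trans ?_)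
    exact (Lp.coeFn_smul c (T v)).symm
  have h1 : ‖(Linf.of (fun _ => c) (memLp_top_const (μ := μ) c) • v : Gam μ E p)‖ = c * ‖v‖ := by
    refine (congrArg norm e1).trans ?_
    rw [norm_smul, Real.norm_of_nonneg hc0.le]
    rfl
  have h2 := h (x := Linf.of (fun _ => c) (memLp_top_const (μ := μ) c) • v) (by
    rw [dist_zero_right, h1, hc]
    field_simp
    norm_num)
  rw [map_zero, dist_zero_right, e2, norm_smul, Real.norm_of_nonneg hc0.le, hc] at h2
  field_simp at h2 ⊢
  linarith

/-- Two elements of the unit ball can be glued along a measurable set so as to realize the maximum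
of their images under `T`. -/
lemma exists_max (T : ModuleDual μ (Gam μ E p)) {v w : Gam μ E p} (hv : Gam.InUnitBall v)
    (hw : Gam.InUnitBall w) :
    ∃ u : Gam μ E p, Gam.InUnitBall u ∧ T u =ᵐ[μ] fun x => max (T v x) (T w x) := by
  set A : Set X := {x | T w x ≤ T v x}
  have hA : MeasurableSet A := measurableSet_le
    (Lp.stronglyMeasurable (T w)).measurable (Lp.stronglyMeasurable (T v)).measurable
  have hfA : MemLp (ind A) ∞ μ := memLp_ind hA
  have hfA' : MemLp (ind Aᶜ) ∞ μ := memLp_ind hA.compl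
  refine ⟨Linf.of (ind A) hfA • v + Linf.of (ind Aᶜ) hfA' • w, ?_, ?_⟩
  · filter_upwards [hv, hw, Gam.coeFn_add (Linf.of (ind A) hfA • v)
      (Linf.of (ind Aᶜ) hfA' • w), Gam.coeFn_of_smul hfA v,
      Gam.coeFn_of_smul hfA' w] with x h1 h2 h3 h4 h5
    rw [h3, h4, h5]
    by_cases hx : x ∈ A <;> simp [hx, h1, h2]
  · filter_upwards [coeFn_map_add T (Linf.of (ind A) hfA • v)
      (Linf.of (ind Aᶜ) hfA' • w), coeFn_of_smul T hfA v,
      coeFn_of_smul T hfA' w] with x h3 h4 h5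
    rw [h3, h4, h5]
    by_cases hx : x ∈ A
    · have : T w x ≤ T v x := hx
      simp [hx, this]
    · have : T v x ≤ T w x := (not_le.1 hx).le
      simp [hx, this]

/-- An a.e. bound for `T` on the unit ball bounds `T` everywhere: test with `v / max |v| ε`. -/
lemma abs_le_of_le (T : ModuleDual μ (Gam μ E p)) {g : X → ℝ}
    (hg : ∀ v, Gam.InUnitBall v → ∀ᵐ x ∂μ, T v x ≤ g x) (v : Gam μ E p) :
    ∀ᵐ x ∂μ, |T v x| ≤ g x * ‖Gam.val v x‖ := by
  have key : ∀ v : Gam μ E p, ∀ᵐ x ∂μ, T v x ≤ g x * ‖Gam.val v x‖ := by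
    intro v
    have h : ∀ᵐ x ∂μ, ∀ n : ℕ, T v x ≤ g x * max ‖Gam.val v x‖ (1 / ((n : ℝ) + 1)) := by
      refine ae_all_iff.2 fun n => ?_
      have hε : 0 < 1 / ((n : ℝ) + 1) := by positivity
      set ε := 1 / ((n : ℝ) + 1)
      have hf : MemLp (fun x => (max ‖Gam.val v x‖ ε)⁻¹) ∞ μ := by
        refine memLp_top_of_bound ?_ ε⁻¹ (ae_of_all _ fun x => ?_)
        · exact ((Gam.memLp v).1.norm.aemeasurable.max aemeasurable_const).inv.aestronglyMeasurable
        · rw [norm_inv, Real.norm_of_nonneg (hε.le.trans (le_max_right _ _))]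
          exact inv_anti₀ hε (le_max_right _ _)
      have h1 := hg (Linf.of _ hf • v) (by
        filter_upwards [Gam.coeFn_of_smul hf v] with x hx
        have hpos : 0 < max ‖Gam.val v x‖ ε := lt_max_of_lt_right hε
        rw [hx, norm_smul, norm_inv, Real.norm_of_nonneg hpos.le, inv_mul_le_one₀ hpos]
        exact le_max_left _ _)
      filter_upwards [h1, coeFn_of_smul T hf v] with x h2 h3
      have hpos : 0 < max ‖Gam.val v x‖ ε := lt_max_of_lt_right hε
      rwa [h3, inv_mul_le_iff₀ hpos, mul_comm] at h2
    filter_upwards [h] with x hx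
    have hlim : Tendsto (fun n : ℕ => g x * max ‖Gam.val v x‖ (1 / ((n : ℝ) + 1))) atTop
        (𝓝 (g x * max ‖Gam.val v x‖ 0)) :=
      (tendsto_const_nhds.max tendsto_one_div_add_atTop_nhds_zero_nat).const_mul _
    rw [max_eq_left (norm_nonneg _)] at hlim
    exact ge_of_tendsto' hlim hx
  have hneg : MemLp (fun _ : X => (-1 : ℝ)) ∞ μ := memLp_top_const _
  filter_upwards [key v, key (Linf.of _ hneg • v), Gam.coeFn_of_smul hneg v,
    coeFn_of_smul T hneg v] with x h1 h2 h3 h4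
  rw [h3, h4, norm_smul, norm_neg, norm_one, one_mul] at h2
  exact abs_le'.2 ⟨h1, by linarith⟩

/-- The `L^q` bound for truncations of `T v`, obtained by testing `T` against `a ^ (q - 1) v`, where
`a` is the truncation. -/
lemma lintegral_truncation_le (hp₁ : 1 < p) (hp : p ≠ ∞) (hpq : p.HolderConjugate q)
    (T : ModuleDual μ (Gam μ E p)) {K : ℝ}
    (hT : ∀ v, ‖T v‖ ≤ K * ‖v‖) {v : Gam μ E p} (hv : Gam.InUnitBall v) (n : ℕ) :
    ∫⁻ x, ENNReal.ofReal (min (max (T v x) 0) n) ^ q.toReal ∂μ ≤ ENNReal.ofReal K ^ q.toReal := by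
  have hpr : 1 < p.toReal := by
    rw [← ENNReal.toReal_one]
    exact (ENNReal.toReal_lt_toReal ENNReal.one_ne_top hp).2 hp₁
  have hc : p.toReal.HolderConjugate q.toReal := ENNReal.HolderConjugate.toReal hpr
  have hq0 : 0 < q.toReal := hc.symm.pos
  have hq1 : 0 < q.toReal - 1 := hc.symm.sub_one_pos
  set a : X → ℝ := fun x => min (max (T v x) 0) n with ha
  have ha0 : ∀ x, 0 ≤ a x := fun x => le_min (le_max_right _ _) n.cast_nonneg
  have han : ∀ x, a x ≤ n := fun x => min_le_right _ _
  have ham : Measurable a := ((Lp.stronglyMeasurable (T v)).measurable.max measurable_const).min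
    measurable_const
  set f : X → ℝ := fun x => a x ^ (q.toReal - 1) with hfd
  have hf0 : ∀ x, 0 ≤ f x := fun x => Real.rpow_nonneg (ha0 x) _
  have hfm : Measurable f := ham.pow_const _
  have hf : MemLp f ∞ μ := memLp_top_of_bound hfm.aestronglyMeasurable
    ((n : ℝ) ^ (q.toReal - 1)) (ae_of_all _ fun x => by
      rw [Real.norm_of_nonneg (hf0 x)]
      exact Real.rpow_le_rpow (ha0 x) (han x) hq1.le)
  have hprod : ∀ x, f x * a x = a x ^ q.toReal := by
    intro x
    rcases (ha0 x).eq_or_lt with h | h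
    · rw [← h, mul_zero, Real.zero_rpow hq0.ne']
    · rw [hfd, ← Real.rpow_add_one h.ne']
      congr 1
      ring
  have hle : ∀ x, a x ^ q.toReal ≤ |f x * T v x| := by
    intro x
    rw [← hprod]
    rcases le_total (T v x) 0 with h | h
    · have : a x = 0 := by
        simp only [ha, max_eq_right h]
        exact min_eq_left n.cast_nonneg
      rw [this, mul_zero]
      exact abs_nonneg _
    · refine le_trans ?_ (le_abs_self _)
      refine mul_le_mul_of_nonneg_left ?_ (hf0 x)
      simp only [ha, max_eq_left h]
      exact min_le_left _ _
  set J : ℝ≥0∞ := ∫⁻ x, ENNReal.ofReal (a x) ^ q.toReal ∂μ with hJ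
  have hpow : ∀ x, ENNReal.ofReal (a x) ^ q.toReal = ENNReal.ofReal (a x ^ q.toReal) :=
    fun x => ENNReal.ofReal_rpow_of_nonneg (ha0 x) hq0.le
  have hJle : J ≤ eLpNorm (T (Linf.of f hf • v)) 1 μ := by
    rw [eLpNorm_one_eq_lintegral_enorm]
    refine lintegral_mono_ae ?_
    filter_upwards [coeFn_of_smul T hf v] with x hx
    rw [hx, hpow, ← ofReal_norm, Real.norm_eq_abs]
    exact ENNReal.ofReal_le_ofReal (hle x)
  -- `J` is finite because the truncation is bounded; a power of it is cancelled below.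
  have hJtop : J ≠ ∞ := (hJle.trans_lt (Lp.memLp _).2).ne
  have hfJ : eLpNorm (Gam.val (Linf.of f hf • v)) p μ ≤ J ^ (1 / p.toReal) := by
    refine (eLpNorm_mono_ae (g := f) ?_).trans ?_
    · filter_upwards [Gam.coeFn_of_smul hf v, hv] with x h1 h2
      rw [h1, norm_smul]
      exact mul_le_of_le_one_right (norm_nonneg _) h2
    · rw [eLpNorm_eq_lintegral_rpow_enorm_toReal (zero_lt_one.trans hp₁).ne' hp]
      refine ENNReal.rpow_le_rpow (lintegral_mono fun x => ?_) (by positivity)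
      rw [hpow, ← ofReal_norm, Real.norm_of_nonneg (hf0 x),
        ENNReal.ofReal_rpow_of_nonneg (hf0 x) hc.pos.le]
      refine ENNReal.ofReal_le_ofReal (le_of_eq ?_)
      rw [hfd, ← Real.rpow_mul (ha0 x), hc.symm.sub_one_mul_conj]
  have hKJ : J ≤ ENNReal.ofReal K * J ^ (1 / p.toReal) := by
    refine hJle.trans ?_
    have h1 := hT (Linf.of f hf • v)
    have h2 : ENNReal.ofReal ‖T (Linf.of f hf • v)‖ = eLpNorm (T (Linf.of f hf • v)) 1 μ := by
      rw [ofReal_norm, Lp.enorm_def]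
    have h3 : ENNReal.ofReal ‖Linf.of f hf • v‖ = eLpNorm (Gam.val (Linf.of f hf • v)) p μ := by
      rw [ofReal_norm]
      exact Lp.enorm_def _
    rw [← h2]
    refine (ENNReal.ofReal_le_ofReal h1).trans ?_
    rw [ENNReal.ofReal_mul' (norm_nonneg _), h3]
    gcongr
  rcases eq_or_ne J 0 with h0 | h0
  · rw [h0]
    exact zero_le
  have hsplit : J = J ^ (1 / q.toReal) * J ^ (1 / p.toReal) := by
    rw [← ENNReal.rpow_add _ _ h0 hJtop, one_div, one_div, hc.symm.inv_add_inv_eq_one,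
      ENNReal.rpow_one]
  have hne0 : J ^ (1 / p.toReal) ≠ 0 := by
    simp [ENNReal.rpow_eq_zero_iff, h0, hJtop]
  have hneT : J ^ (1 / p.toReal) ≠ ∞ := ENNReal.rpow_ne_top_of_nonneg (by positivity) hJtop
  have hfin : J ^ (1 / q.toReal) ≤ ENNReal.ofReal K := by
    refine (ENNReal.mul_le_mul_iff_left hne0 hneT).1 ?_
    rw [← hsplit]
    exact hKJ
  calc J = (J ^ (1 / q.toReal)) ^ q.toReal := by
        rw [← ENNReal.rpow_mul, one_div_mul_cancel hq0.ne', ENNReal.rpow_one]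
    _ ≤ _ := ENNReal.rpow_le_rpow hfin hq0.le

end ModuleDual

/-- Every family of measurable functions over a `σ`-finite measure has a countable subfamily with
the same essential supremum. -/
lemma exists_seq_dominating [SigmaFinite μ] {ι : Type*} [Nonempty ι] (f : ι → X →ₘ[μ] ℝ) :
    ∃ s : ℕ → ι, ∀ i, ∀ᵐ x ∂μ, ∀ r : ℝ, r < f i x → ∃ n, r < f (s n) x := by
  classical
  have key : ∀ r : ℚ, ∃ D : Set ι, D.Countable ∧
      ∀ i, ∀ᵐ x ∂μ, (r : ℝ) < f i x → ∃ j ∈ D, (r : ℝ) < f j x := by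
    intro r
    obtain ⟨D, hDS, hDc, hD⟩ := Measure.exists_ae_subset_biUnion_countable μ
      (C := Set.range fun i => {x | (r : ℝ) < f i x}) (by
        rintro _ ⟨i, rfl⟩
        exact measurableSet_lt measurable_const (f i).measurable)
    choose g hg using fun s : D => hDS s.2
    have : Countable D := hDc
    refine ⟨Set.range g, Set.countable_range g, fun i => ?_⟩
    filter_upwards [hD _ ⟨i, rfl⟩] with x hx hlt
    obtain ⟨s, hs, hxs⟩ := hx hlt
    exact ⟨g ⟨s, hs⟩, ⟨⟨s, hs⟩, rfl⟩, (Set.ext_iff.1 (hg ⟨s, hs⟩) x).2 hxs⟩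
  choose D hDc hD using key
  obtain ⟨s, hs⟩ : ∃ s : ℕ → ι, (⋃ r, D r) ⊆ Set.range s := by
    rcases (⋃ r, D r).eq_empty_or_nonempty with h | h
    · exact ⟨fun _ => Classical.arbitrary ι, by simp [h]⟩
    · obtain ⟨s, hs⟩ := (Set.countable_iUnion hDc).exists_eq_range h
      exact ⟨s, hs.le⟩
  refine ⟨s, fun i => ?_⟩
  filter_upwards [ae_all_iff.2 fun r => hD r i] with x hx r hr
  obtain ⟨t, ht1, ht2⟩ := exists_rat_btwn hr
  obtain ⟨j, hj, hj'⟩ := hx t ht2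
  obtain ⟨n, rfl⟩ := hs (Set.mem_iUnion.2 ⟨t, hj⟩)
  exact ⟨n, ht1.trans hj'⟩

namespace ModuleDual

/-- There is a sequence in the unit ball along which `T` increases to its supremum over the unit
ball. -/
lemma exists_seq [SigmaFinite μ] (T : ModuleDual μ (Gam μ E p)) :
    ∃ w : ℕ → Gam μ E p, (∀ n, Gam.InUnitBall (w n)) ∧
      (∀ n, ∀ᵐ x ∂μ, T (w n) x ≤ T (w (n + 1)) x) ∧
      ∀ v, Gam.InUnitBall v → ∀ᵐ x ∂μ, ∀ r : ℝ, r < T v x → ∃ n, r < T (w n) x := by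
  have : Nonempty {v : Gam μ E p // Gam.InUnitBall v} := ⟨⟨0, Gam.inUnitBall_zero⟩⟩
  obtain ⟨s, hs⟩ := exists_seq_dominating (μ := μ)
    fun v : {v : Gam μ E p // Gam.InUnitBall v} => (T v.1 : X →ₘ[μ] ℝ)
  choose m hm1 hm2 using fun v w : {v : Gam μ E p // Gam.InUnitBall v} => exists_max T v.2 w.2
  let w : ℕ → {v : Gam μ E p // Gam.InUnitBall v} :=
    fun n => Nat.rec (s 0) (fun n u => ⟨m u (s (n + 1)), hm1 u (s (n + 1))⟩) n
  have hw : ∀ n, T (w (n + 1)).1 =ᵐ[μ] fun x => max (T (w n).1 x) (T (s (n + 1)).1 x) :=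
    fun n => hm2 (w n) (s (n + 1))
  have hsw : ∀ n, ∀ᵐ x ∂μ, T (s n).1 x ≤ T (w n).1 x := by
    intro n
    cases n with
    | zero => exact ae_of_all _ fun x => le_rfl
    | succ n =>
      filter_upwards [hw n] with x hx
      rw [hx]
      exact le_max_right _ _
  refine ⟨fun n => (w n).1, fun n => (w n).2, fun n => ?_, fun v hv => ?_⟩
  · filter_upwards [hw n] with x hx
    rw [hx]
    exact le_max_left _ _
  · filter_upwards [hs ⟨v, hv⟩, ae_all_iff.2 hsw] with x h1 h2 r hr
    obtain ⟨n, hn⟩ := h1 r hr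
    exact ⟨n, hn.trans_le (h2 n)⟩

/-- A bounded `T` is dominated on the unit ball by a function in `L^q` whose norm is at most the
bound of `T`. -/
lemma exists_dominating [SigmaFinite μ] (hp₁ : 1 < p) (hp : p ≠ ∞) (hpq : p.HolderConjugate q)
    (T : ModuleDual μ (Gam μ E p)) {K : ℝ} (hT : ∀ v, ‖T v‖ ≤ K * ‖v‖) :
    ∃ g : X → ℝ, MemLp g q μ ∧ eLpNorm g q μ ≤ ENNReal.ofReal K ∧
      ∀ v, Gam.InUnitBall v → ∀ᵐ x ∂μ, T v x ≤ g x := by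
  have hpr : 1 < p.toReal := by
    rw [← ENNReal.toReal_one]
    exact (ENNReal.toReal_lt_toReal ENNReal.one_ne_top hp).2 hp₁
  have hc : p.toReal.HolderConjugate q.toReal := ENNReal.HolderConjugate.toReal hpr
  have hq0 : 0 < q.toReal := hc.symm.pos
  obtain ⟨hq0', hqT⟩ := ENNReal.toReal_pos_iff.1 hq0
  obtain ⟨w, hw1, hw2, hw3⟩ := exists_seq T
  let h : ℕ → X → ℝ≥0∞ := fun n x => ENNReal.ofReal (min (max (T (w n) x) 0) n) ^ q.toReal
  have hhm : ∀ n, Measurable (h n) := fun n =>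
    (((Lp.stronglyMeasurable (T (w n))).measurable.max measurable_const).min
      measurable_const).ennreal_ofReal.pow_const _
  have hmono : ∀ᵐ x ∂μ, Monotone fun n => h n x := by
    filter_upwards [ae_all_iff.2 hw2] with x hx
    refine monotone_nat_of_le_succ fun n => ?_
    refine ENNReal.rpow_le_rpow (ENNReal.ofReal_le_ofReal ?_) hq0.le
    exact min_le_min (max_le_max (hx n) le_rfl) (by exact_mod_cast n.le_succ)
  let G : X → ℝ≥0∞ := fun x => ⨆ n, h n x
  have hGm : Measurable G := Measurable.iSup hhm
  have hG : ∫⁻ x, G x ∂μ ≤ ENNReal.ofReal K ^ q.toReal := by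
    rw [lintegral_iSup' (fun n => (hhm n).aemeasurable) hmono]
    exact iSup_le fun n => lintegral_truncation_le hp₁ hp hpq T hT (hw1 n) n
  have hGfin : ∀ᵐ x ∂μ, G x < ∞ := ae_lt_top hGm
    (hG.trans_lt (ENNReal.rpow_lt_top_of_nonneg hq0.le ENNReal.ofReal_ne_top)).ne
  let g : X → ℝ := fun x => (G x).toReal ^ (1 / q.toReal)
  have hg0 : ∀ x, 0 ≤ g x := fun x => Real.rpow_nonneg ENNReal.toReal_nonneg _
  have hgm : Measurable g := hGm.ennreal_toReal.pow_const _
  have hgG : ∀ x, G x < ∞ → ‖g x‖ₑ ^ q.toReal = G x := by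
    intro x hx
    rw [← ofReal_norm, Real.norm_of_nonneg (hg0 x),
      ENNReal.ofReal_rpow_of_nonneg (hg0 x) hq0.le, ← Real.rpow_mul ENNReal.toReal_nonneg,
      one_div_mul_cancel hq0.ne', Real.rpow_one, ENNReal.ofReal_toReal hx.ne]
  have hgK : eLpNorm g q μ ≤ ENNReal.ofReal K := by
    rw [eLpNorm_eq_lintegral_rpow_enorm_toReal hq0'.ne' hqT.ne,
      lintegral_congr_ae (hGfin.mono hgG)]
    calc _ ≤ (ENNReal.ofReal K ^ q.toReal) ^ (1 / q.toReal) :=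
          ENNReal.rpow_le_rpow hG (by positivity)
      _ = _ := by rw [← ENNReal.rpow_mul, mul_one_div_cancel hq0.ne', ENNReal.rpow_one]
  refine ⟨g, ⟨hgm.aestronglyMeasurable, hgK.trans_lt ENNReal.ofReal_lt_top⟩, hgK, fun v hv => ?_⟩
  filter_upwards [hw3 v hv, ae_all_iff.2 hw2, hGfin] with x h1 h2 h3
  refine le_of_forall_lt fun r hr => ?_
  obtain ⟨r', hr1, hr2⟩ := exists_between hr
  refine hr1.trans_le ?_
  rcases le_total r' 0 with h0 | h0
  · exact h0.trans (hg0 x)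
  obtain ⟨n, hn⟩ := h1 r' hr2
  obtain ⟨k, hk⟩ := exists_nat_ge r'
  have hmon : Monotone fun n => T (w n) x := monotone_nat_of_le_succ h2
  have h5 : ENNReal.ofReal r' ^ q.toReal ≤ G x := by
    refine le_trans ?_ (le_iSup (fun n => h n x) (max n k))
    refine ENNReal.rpow_le_rpow (ENNReal.ofReal_le_ofReal ?_) hq0.le
    refine le_min (le_max_of_le_left (hn.le.trans (hmon (le_max_left _ _)))) (hk.trans ?_)
    exact_mod_cast le_max_right n k
  rw [← hgG x h3, ENNReal.rpow_le_rpow_iff hq0, ← ofReal_norm,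
    Real.norm_of_nonneg (hg0 x)] at h5
  exact (ENNReal.ofReal_le_ofReal_iff (hg0 x)).1 h5

variable [SigmaFinite μ]

lemma isLUB_dualPtNorm (T : ModuleDual μ (Gam μ E p)) :
    IsLUB {g | ∃ v : Gam μ E p, Gam.InUnitBall v ∧ g = toExt (T v : X →ₘ[μ] ℝ)}
      (dualPtNorm (Gam.ptNorm (μ := μ) (E := E) (p := p)) T) := by
  have h : {g | ∃ v : Gam μ E p, Gam.InUnitBall v ∧ g = toExt (T v : X →ₘ[μ] ℝ)} =
      {g | ∃ v : Gam μ E p, (∀ᵐ x ∂μ, Gam.ptNorm v x ≤ 1) ∧ g = toExt (T v : X →ₘ[μ] ℝ)} := by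
    ext g
    refine exists_congr fun v => and_congr_left' (eventually_congr ?_)
    filter_upwards [Gam.coeFn_ptNorm v] with x hx
    rw [hx]
  rw [h]
  exact isLUB_famSup _

/-- The pointwise norm of a bounded `T` belongs to `L^q`, with norm at most the bound of `T`. -/
lemma exists_ptNorm (hp₁ : 1 < p) (hp : p ≠ ∞) (hpq : p.HolderConjugate q)
    (T : ModuleDual μ (Gam μ E p)) {K : ℝ} (hK : 0 ≤ K) (hT : ∀ v, ‖T v‖ ≤ K * ‖v‖) :
    ∃ k : Lp ℝ q μ, toExt (k : X →ₘ[μ] ℝ) =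
      dualPtNorm (Gam.ptNorm (μ := μ) (E := E) (p := p)) T ∧ ‖k‖ ≤ K := by
  obtain ⟨g, hg, hgK, hle⟩ := exists_dominating hp₁ hp hpq T hT
  set s := dualPtNorm (Gam.ptNorm (μ := μ) (E := E) (p := p)) T with hs
  have hs0 : ∀ᵐ x ∂μ, 0 ≤ s x := by
    have h1 := AEEqFun.coeFn_le.2 ((isLUB_dualPtNorm T).1 ⟨0, Gam.inUnitBall_zero, rfl⟩)
    filter_upwards [h1, coeFn_toExt (T 0 : X →ₘ[μ] ℝ), coeFn_map_zero T] with x h2 h3 h4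
    rw [h3, h4, EReal.coe_zero] at h2
    exact h2
  have hsg : ∀ᵐ x ∂μ, s x ≤ ((g x : ℝ) : EReal) := by
    have h1 : s ≤ toExt (AEEqFun.mk g hg.1) := by
      refine (isLUB_dualPtNorm T).2 ?_
      rintro _ ⟨v, hv, rfl⟩
      rw [toExt_le_toExt]
      filter_upwards [hle v hv, AEEqFun.coeFn_mk g hg.1] with x h1 h2
      rwa [h2]
    filter_upwards [AEEqFun.coeFn_le.2 h1, coeFn_toExt (AEEqFun.mk g hg.1),
      AEEqFun.coeFn_mk g hg.1] with x h2 h3 h4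
    rwa [h3, h4] at h2
  have hreal : ∀ᵐ x ∂μ, (((s x).toReal : ℝ) : EReal) = s x ∧ 0 ≤ (s x).toReal ∧
      (s x).toReal ≤ g x := by
    filter_upwards [hs0, hsg] with x h1 h2
    have hbot : s x ≠ ⊥ := (EReal.bot_lt_zero.trans_le h1).ne'
    refine ⟨EReal.coe_toReal (h2.trans_lt (EReal.coe_lt_top _)).ne hbot,
      EReal.toReal_nonneg h1, ?_⟩
    rw [← EReal.toReal_coe (g x)]
    exact EReal.toReal_le_toReal h2 hbot (EReal.coe_ne_top _)
  have hle' : ∀ᵐ x ∂μ, ‖(s x).toReal‖ ≤ ‖g x‖ := by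
    filter_upwards [hreal] with x hx
    rw [Real.norm_of_nonneg hx.2.1]
    exact hx.2.2.trans (Real.le_norm_self _)
  have hm : MemLp (fun x => (s x).toReal) q μ :=
    hg.mono s.measurable.ereal_toReal.aestronglyMeasurable hle'
  refine ⟨hm.toLp, AEEqFun.ext ?_, ?_⟩
  · filter_upwards [coeFn_toExt (hm.toLp : X →ₘ[μ] ℝ), hm.coeFn_toLp, hreal] with x h1 h2 h3
    rw [h1, h2, h3.1]
  · rw [Lp.norm_toLp]
    refine ENNReal.toReal_le_of_le_ofReal hK ((eLpNorm_mono_ae hle').trans hgK)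

variable {N : ModuleDual μ (Gam μ E p) → Lp ℝ q μ}
  (hN : ∀ T, toExt (N T : X →ₘ[μ] ℝ) = dualPtNorm (Gam.ptNorm (μ := μ) (E := E) (p := p)) T)

include hN

lemma apply_le_ptNorm (T : ModuleDual μ (Gam μ E p)) {v : Gam μ E p} (hv : Gam.InUnitBall v) :
    ∀ᵐ x ∂μ, T v x ≤ N T x :=
  toExt_le_toExt.1 ((hN T).symm ▸ (isLUB_dualPtNorm T).1 ⟨v, hv, rfl⟩)

lemma ptNorm_le (T : ModuleDual μ (Gam μ E p)) {h : X → ℝ} (hm : AEStronglyMeasurable h μ)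
    (hle : ∀ v, Gam.InUnitBall v → ∀ᵐ x ∂μ, T v x ≤ h x) : ∀ᵐ x ∂μ, N T x ≤ h x := by
  have h1 : toExt (N T : X →ₘ[μ] ℝ) ≤ toExt (AEEqFun.mk h hm) := by
    rw [hN]
    refine (isLUB_dualPtNorm T).2 ?_
    rintro _ ⟨v, hv, rfl⟩
    rw [toExt_le_toExt]
    filter_upwards [hle v hv, AEEqFun.coeFn_mk h hm] with x h1 h2
    rwa [h2]
  filter_upwards [toExt_le_toExt.1 h1, AEEqFun.coeFn_mk h hm] with x h2 h3
  rwa [h3] at h2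

lemma abs_apply_le (T : ModuleDual μ (Gam μ E p)) (v : Gam μ E p) :
    ∀ᵐ x ∂μ, |T v x| ≤ N T x * ‖Gam.val v x‖ :=
  abs_le_of_le T (fun _ hv => apply_le_ptNorm hN T hv) v

lemma norm_apply_le (hpq : p.HolderConjugate q) (T : ModuleDual μ (Gam μ E p)) (v : Gam μ E p) :
    ‖T v‖ ≤ ‖N T‖ * ‖v‖ := by
  have hqp : q.HolderConjugate p := hpq.symm
  have h1 : eLpNorm (T v) 1 μ ≤ eLpNorm (N T) q μ * eLpNorm (Gam.val v) p μ := by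
    refine (eLpNorm_mono_ae (g := (N T : X → ℝ) • fun x => ‖Gam.val v x‖) ?_).trans
      ((eLpNorm_smul_le_mul_eLpNorm (p := q) (q := p) (r := 1) (Gam.memLp v).1.norm
        (Lp.aestronglyMeasurable (N T))).trans_eq ?_)
    · filter_upwards [abs_apply_le hN T v] with x hx
      exact hx.trans (le_abs_self _)
    · rw [eLpNorm_norm]
  have h2 : ‖v‖ = (eLpNorm (Gam.val v) p μ).toReal := Lp.norm_def _
  rw [h2, Lp.norm_def, Lp.norm_def, ← ENNReal.toReal_mul]
  exact ENNReal.toReal_mono (ENNReal.mul_ne_top (Lp.eLpNorm_ne_top _) (Gam.memLp v).2.ne) h1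

omit hN [SigmaFinite μ] in
lemma coeFn_add_apply (T T' : ModuleDual μ (Gam μ E p)) (v : Gam μ E p) :
    (T + T') v =ᵐ[μ] fun x => T v x + T' v x := Lp.coeFn_add (T v) (T' v)

omit hN [SigmaFinite μ] in
lemma coeFn_smul_apply (f : Linf μ) (T : ModuleDual μ (Gam μ E p)) (v : Gam μ E p) :
    (f • T) v =ᵐ[μ] fun x => (f : X →ₘ[μ] ℝ) x * T v x := coeFn_linf_smul f (T v)

lemma ptNorm_nonneg (T : ModuleDual μ (Gam μ E p)) : ∀ᵐ x ∂μ, 0 ≤ N T x := by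
  filter_upwards [apply_le_ptNorm hN T Gam.inUnitBall_zero, coeFn_map_zero T] with x h1 h2
  rwa [h2] at h1

lemma isLpNormedModule : IsLpNormedModule q N where
  nonneg T := ptNorm_nonneg hN T
  eq_zero_iff T := by
    constructor
    · intro h
      refine ContinuousLinearMap.ext fun v => Lp.ext ?_
      filter_upwards [h, abs_apply_le hN T v, Lp.coeFn_zero ℝ 1 μ] with x h1 h2 h3
      rw [h1, Pi.zero_apply, zero_mul] at h2
      change T v x = (0 : Lp ℝ 1 μ) x
      rw [h3, Pi.zero_apply]
      exact abs_nonpos_iff.1 h2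
    · rintro rfl
      filter_upwards [ptNorm_nonneg hN 0, ptNorm_le hN 0
        (aestronglyMeasurable_const (b := (0 : ℝ))) (fun v _ => by
          filter_upwards [Lp.coeFn_zero ℝ 1 μ] with x hx
          exact hx.le)] with x h1 h2
      exact le_antisymm h2 h1
  add_le T T' := by
    refine ptNorm_le hN _ ((Lp.aestronglyMeasurable (N T)).add (Lp.aestronglyMeasurable (N T')))
      fun v hv => ?_
    filter_upwards [coeFn_add_apply T T' v, apply_le_ptNorm hN T hv, apply_le_ptNorm hN T' hv]
      with x h1 h2 h3
    rw [h1]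
    exact add_le_add h2 h3
  smul_eq f T := by
    have hfm : Measurable fun x => (f : X →ₘ[μ] ℝ) x := (f : X →ₘ[μ] ℝ).measurable
    have h1 : ∀ᵐ x ∂μ, N (f • T) x ≤ |(f : X →ₘ[μ] ℝ) x| * N T x := by
      refine ptNorm_le hN _ (hfm.abs.aestronglyMeasurable.mul (Lp.aestronglyMeasurable (N T)))
        fun v hv => ?_
      filter_upwards [coeFn_smul_apply f T v, abs_apply_le hN T v, hv, ptNorm_nonneg hN T]
        with x h1 h2 h3 h4
      rw [h1]
      refine (le_abs_self _).trans ?_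
      rw [abs_mul]
      exact mul_le_mul_of_nonneg_left (h2.trans (mul_le_of_le_one_right h4 h3)) (abs_nonneg _)
    -- The reverse inequality: where `f ≠ 0`, the quotient `|f T| / |f|` dominates `T` on the unit
    -- ball, hence also `|T|`.
    set h : X → ℝ := fun x => if (f : X →ₘ[μ] ℝ) x = 0 then N T x
      else N (f • T) x / |(f : X →ₘ[μ] ℝ) x| with hh
    have hhm : Measurable h := Measurable.ite (hfm (measurableSet_singleton 0))
      (Lp.stronglyMeasurable (N T)).measurable
      ((Lp.stronglyMeasurable (N (f • T))).measurable.div hfm.abs)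
    have h2 : ∀ᵐ x ∂μ, N T x ≤ h x := by
      refine ptNorm_le hN _ hhm.aestronglyMeasurable fun v hv => ?_
      filter_upwards [coeFn_smul_apply f T v, abs_apply_le hN (f • T) v, hv,
        ptNorm_nonneg hN (f • T), apply_le_ptNorm hN T hv] with x h2 h3 h4 h5 h6
      simp only [hh]
      split_ifs with h0
      · exact h6
      · rw [le_div_iff₀ (abs_pos.2 h0), mul_comm]
        rw [h2, abs_mul] at h3
        exact (mul_le_mul_of_nonneg_left (le_abs_self _) (abs_nonneg _)).trans
          (h3.trans (mul_le_of_le_one_right h5 h4))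
    filter_upwards [h1, h2, ptNorm_nonneg hN (f • T)] with x h3 h4 h5
    refine le_antisymm h3 ?_
    simp only [hh] at h4
    split_ifs at h4 with h0
    · rw [h0, abs_zero, zero_mul]
      exact h5
    · rwa [le_div_iff₀ (abs_pos.2 h0), mul_comm] at h4

/-- Completeness of the module dual: a Cauchy sequence converges pointwise in `L¹`, and the bound
of the differences passes to the limit. -/
lemma isLpBanachModule (hp₁ : 1 < p) (hp : p ≠ ∞) (hpq : p.HolderConjugate q) :
    IsLpBanachModule q N := by
  refine ⟨isLpNormedModule hN, fun u hu => ?_⟩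
  have hdiff : ∀ m n v, ‖u m v - u n v‖ ≤ ‖N (u m - u n)‖ * ‖v‖ := fun m n v =>
    norm_apply_le hN hpq (u m - u n) v
  have hcauchy : ∀ v, CauchySeq fun n => u n v := by
    intro v
    refine Metric.cauchySeq_iff.2 fun ε hε => ?_
    obtain ⟨n₀, h⟩ := hu (ε / (‖v‖ + 1)) (by positivity)
    refine ⟨n₀, fun m hm n hn => ?_⟩
    rw [dist_eq_norm]
    calc ‖u m v - u n v‖ ≤ ‖N (u m - u n)‖ * ‖v‖ := hdiff m n v
      _ ≤ ε / (‖v‖ + 1) * ‖v‖ := by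
          exact mul_le_mul_of_nonneg_right (h m hm n hn).le (norm_nonneg _)
      _ < ε / (‖v‖ + 1) * (‖v‖ + 1) := by
          have : 0 < ε / (‖v‖ + 1) := by positivity
          exact mul_lt_mul_of_pos_left (lt_add_one _) this
      _ = ε := by field_simp
  choose L hL using fun v => cauchySeq_tendsto_of_complete (hcauchy v)
  let L' : Gam μ E p →ₗ[Linf μ] Lp ℝ 1 μ :=
    linearMapOfTendsto L (fun n => (u n : Gam μ E p →ₗ[Linf μ] Lp ℝ 1 μ)) (tendsto_pi_nhds.2 hL)
  have hL' : ∀ ε > 0, ∃ n₀, ∀ n ≥ n₀, ∀ v, ‖u n v - L' v‖ ≤ ε * ‖v‖ := by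
    intro ε hε
    obtain ⟨n₀, h⟩ := hu ε hε
    refine ⟨n₀, fun n hn v => ?_⟩
    refine le_of_tendsto ((tendsto_const_nhds.sub (hL v)).norm) ?_
    filter_upwards [eventually_ge_atTop n₀] with m hm
    exact (hdiff n m v).trans (mul_le_mul_of_nonneg_right (h n hn m hm).le (norm_nonneg _))
  obtain ⟨n₁, hn₁⟩ := hL' 1 one_pos
  have hLcont : Continuous L' := by
    refine AddMonoidHomClass.continuous_of_bound L' (‖N (u n₁)‖ + 1) fun v => ?_
    have h1 := hn₁ n₁ le_rfl v
    have h2 := norm_apply_le hN hpq (u n₁) v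
    have h3 : ‖L' v‖ ≤ ‖u n₁ v‖ + ‖u n₁ v - L' v‖ := by
      have := norm_sub_le (u n₁ v) (u n₁ v - L' v)
      rwa [sub_sub_cancel] at this
    linarith
  let L'' : ModuleDual μ (Gam μ E p) := ⟨L', hLcont⟩
  refine ⟨L'', Metric.tendsto_atTop.2 fun ε hε => ?_⟩
  obtain ⟨n₀, h⟩ := hL' (ε / 2) (by positivity)
  refine ⟨n₀, fun n hn => ?_⟩
  obtain ⟨k, hk1, hk2⟩ := exists_ptNorm hp₁ hp hpq (u n - L'') (by positivity : 0 ≤ ε / 2) (h n hn)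
  have hk : N (u n - L'') = k := Subtype.ext (toExt_injective ((hN _).trans hk1.symm))
  rw [hk, dist_zero_right, Real.norm_of_nonneg (by exact ENNReal.toReal_nonneg)]
  linarith

end ModuleDual

end

end DualNorm

/-! ### The pairing with weakly* measurable sections -/

section Pairing

open Topology

variable {X : Type*} [MeasurableSpace X] {μ : Measure X}
  {B : Type*} [NormedAddCommGroup B] [NormedSpace ℝ B] {E : BanachBundle X B} {p q : ℝ≥0∞}

/-- Pointwise multiplication of a section by a measurable real function. -/
def Sec.mul (f : X → ℝ) (hf : AEStronglyMeasurable f μ) (v : Sec μ E) : Sec μ E :=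
  ⟨fun x => f x • v.1 x, hf.smul (Sec.aestronglyMeasurable v)⟩

/-- The section that agrees with `v` on the measurable set `A` and vanishes elsewhere. -/
abbrev Sec.cut {A : Set X} (hA : MeasurableSet A) (v : Sec μ E) : Sec μ E :=
  Sec.mul (ind A) (memLp_ind hA).1 v

lemma Sec.norm_cut_le {A : Set X} (hA : MeasurableSet A) (v : Sec μ E) (x : X) :
    ‖((Sec.cut hA v).1 x : B)‖ ≤ ‖(v.1 x : B)‖ := by
  change ‖ind A x • (v.1 x : B)‖ ≤ _
  by_cases hx : x ∈ A
  · rw [ind_of_mem hx, one_smul]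
  · rw [ind_of_notMem hx, zero_smul, norm_zero]
    exact norm_nonneg _

/-- Every section is exhausted by its restrictions to sets on which it is integrable to all powers
and bounded. -/
lemma Sec.exists_cutoff [SigmaFinite μ] (v : Sec μ E) :
    ∃ (A : ℕ → Set X) (hA : ∀ n, MeasurableSet (A n)), (∀ᵐ x ∂μ, ∀ᶠ n in atTop, x ∈ A n) ∧
      ∀ n (r : ℝ≥0∞), MemLp (fun x => ((Sec.cut (hA n) v).1 x : B)) r μ := by
  set v' := v.2.mk _ with hv'
  have hA : ∀ n : ℕ, MeasurableSet (spanningSets μ n ∩ {x | ‖v' x‖ ≤ n}) := fun n =>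
    (measurableSet_spanningSets μ n).inter
      (measurableSet_le v.2.stronglyMeasurable_mk.norm.measurable measurable_const)
  refine ⟨fun n => spanningSets μ n ∩ {x | ‖v' x‖ ≤ n}, hA, ae_of_all _ fun x => ?_, fun n r => ?_⟩
  · obtain ⟨k, hk⟩ := exists_nat_ge ‖v' x‖
    filter_upwards [eventually_ge_atTop k, eventually_ge_atTop (spanningSetsIndex μ x)]
      with n hn1 hn2
    exact ⟨monotone_spanningSets μ hn2 (mem_spanningSetsIndex μ x),
      hk.trans (by exact_mod_cast hn1)⟩
  · have hfin : μ (spanningSets μ n ∩ {x | ‖v' x‖ ≤ n}) ≠ ∞ :=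
      ((measure_mono Set.inter_subset_left).trans_lt (measure_spanningSets_lt_top μ n)).ne
    refine (memLp_indicator_const r (hA n) (n : ℝ) (Or.inr hfin)).mono
      (Sec.aestronglyMeasurable _) ?_
    filter_upwards [v.2.ae_eq_mk] with x hx
    change ‖ind _ x • (v.1 x : B)‖ ≤ _
    by_cases h : x ∈ spanningSets μ n ∩ {x | ‖v' x‖ ≤ n}
    · have h' : ‖(v.1 x : B)‖ ≤ n := by
        rw [hx]
        exact h.2
      rw [ind_of_mem h, Set.indicator_of_mem h, one_smul, Real.norm_natCast]
      exact h'
    · rw [ind_of_notMem h, Set.indicator_of_notMem h, zero_smul, norm_zero, norm_zero]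

lemma GamW₀.coeFn_pair_mk (v : Sec μ E) (ω : WSec μ E) :
    GamW₀.pair v (GamW₀.mk ω) =ᵐ[μ] fun x => ω.1 x (v.1 x) :=
  AEEqFun.coeFn_mk _ (ω.2 v)

lemma GamW₀.pair_congr {v w : Sec μ E}
    (h : (fun x => (v.1 x : B)) =ᵐ[μ] fun x => (w.1 x : B)) (ω : GamW₀ μ E) :
    GamW₀.pair v ω = GamW₀.pair w ω := by
  obtain ⟨ω, rfl⟩ := Submodule.mkQ_surjective _ ω
  refine AEEqFun.ext ?_
  filter_upwards [h, GamW₀.coeFn_pair_mk v ω, GamW₀.coeFn_pair_mk w ω] with x h1 h2 h3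
  refine h2.trans (Eq.trans ?_ h3.symm)
  rw [Subtype.ext h1]

lemma GamW₀.coeFn_pair_mul {f : X → ℝ} (hf : AEStronglyMeasurable f μ) (v : Sec μ E)
    (ω : GamW₀ μ E) : GamW₀.pair (Sec.mul f hf v) ω =ᵐ[μ] fun x => f x * GamW₀.pair v ω x := by
  obtain ⟨ω, rfl⟩ := Submodule.mkQ_surjective _ ω
  filter_upwards [GamW₀.coeFn_pair_mk v ω, GamW₀.coeFn_pair_mk (Sec.mul f hf v) ω] with x h1 h2
  refine h2.trans (((ω.1 x).map_smul (f x) (v.1 x)).trans ?_)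
  exact congrArg (fun t => f x * t) h1.symm

variable [SigmaFinite μ]

/-- The pairing is bounded by the product of the pointwise norms: test with `v / |v|`. -/
lemma GamW.abs_pair_le (ω : GamW μ E q) (v : Sec μ E) :
    ∀ᵐ x ∂μ, |GamW₀.pair v (ω : GamW₀ μ E) x| ≤ GamW.ptNorm ω x * ‖(v.1 x : B)‖ := by
  have hf : AEStronglyMeasurable (fun x => ‖(v.1 x : B)‖⁻¹) μ :=
    v.2.norm.aemeasurable.inv.aestronglyMeasurable
  have h1 := GamW₀.pair_le_of_eq (GamW.toExt_ptNorm ω) (Sec.mul _ hf v) (ae_of_all _ fun x => by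
    change ‖‖(v.1 x : B)‖⁻¹ • (v.1 x : B)‖ ≤ 1
    rw [norm_smul, norm_inv, norm_norm]
    exact inv_mul_le_one)
  obtain ⟨ω', hω'⟩ := Submodule.mkQ_surjective _ (ω : GamW₀ μ E)
  have h4 : GamW₀.pair v (ω : GamW₀ μ E) =ᵐ[μ] fun x => ω'.1 x (v.1 x) := by
    rw [← hω']
    exact GamW₀.coeFn_pair_mk v ω'
  filter_upwards [h1, GamW₀.coeFn_pair_mul hf v (ω : GamW₀ μ E), h4] with x h2 h3 h4
  rcases eq_or_ne (v.1 x) 0 with h0 | h0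
  · rw [h4, h0, map_zero, abs_zero, ZeroMemClass.coe_zero, norm_zero, mul_zero]
  · have hpos : 0 < ‖(v.1 x : B)‖ := norm_pos_iff.2 fun h => h0 (Subtype.ext h)
    rwa [h3, abs_mul, abs_of_pos (inv_pos.2 hpos), inv_mul_le_iff₀ hpos, mul_comm] at h2

lemma GamW.eLpNorm_pair_le (hpq : p.HolderConjugate q) (ω : GamW μ E q) (v : Sec μ E) :
    eLpNorm (GamW₀.pair v (ω : GamW₀ μ E)) 1 μ ≤
      eLpNorm (GamW.ptNorm ω) q μ * eLpNorm (fun x => (v.1 x : B)) p μ := by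
  have hqp : q.HolderConjugate p := hpq.symm
  refine (eLpNorm_mono_ae (g := (GamW.ptNorm ω : X → ℝ) • fun x => ‖(v.1 x : B)‖) ?_).trans
    ((eLpNorm_smul_le_mul_eLpNorm (p := q) (q := p) (r := 1) v.2.norm
      (Lp.aestronglyMeasurable (GamW.ptNorm ω))).trans_eq ?_)
  · filter_upwards [GamW.abs_pair_le ω v] with x hx
    exact hx.trans (le_abs_self _)
  · rw [eLpNorm_norm]

/-- A section of `E` representing an element of `Γ_p(E)`. -/
def Gam.rep (v : Gam μ E p) : Sec μ E := v.2.choose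

omit [SigmaFinite μ] in
lemma Gam.coeFn_rep (v : Gam μ E p) : Gam.val v =ᵐ[μ] fun x => ((Gam.rep v).1 x : B) :=
  v.2.choose_spec

lemma GamW.memLp_pair (hpq : p.HolderConjugate q) (ω : GamW μ E q) (v : Gam μ E p) :
    MemLp (GamW₀.pair (Gam.rep v) (ω : GamW₀ μ E)) 1 μ := by
  refine ⟨AEEqFun.aestronglyMeasurable _, (GamW.eLpNorm_pair_le hpq ω _).trans_lt ?_⟩
  rw [← eLpNorm_congr_ae (Gam.coeFn_rep v)]
  exact ENNReal.mul_lt_top (Lp.memLp _).2 (Gam.memLp v).2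

/-- The pairing of `ω ∈ Γ_q(E'_{w*})` with an element of `Γ_p(E)`, in `L¹(μ)`. -/
def GamW.apply (hpq : p.HolderConjugate q) (ω : GamW μ E q) (v : Gam μ E p) : Lp ℝ 1 μ :=
  (GamW.memLp_pair hpq ω v).toLp

lemma GamW.coeFn_apply_pair (hpq : p.HolderConjugate q) (ω : GamW μ E q) {v : Gam μ E p}
    {s : Sec μ E} (hs : Gam.val v =ᵐ[μ] fun x => (s.1 x : B)) :
    GamW.apply hpq ω v =ᵐ[μ] GamW₀.pair s (ω : GamW₀ μ E) := by
  rw [← GamW₀.pair_congr ((Gam.coeFn_rep v).symm.trans hs)]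
  exact MemLp.coeFn_toLp _

lemma GamW.coeFn_apply (hpq : p.HolderConjugate q) {ω : GamW μ E q} {ω' : WSec μ E}
    (hω : GamW₀.mk ω' = (ω : GamW₀ μ E)) {v : Gam μ E p}
    {s : Sec μ E} (hs : Gam.val v =ᵐ[μ] fun x => (s.1 x : B)) :
    GamW.apply hpq ω v =ᵐ[μ] fun x => ω'.1 x (s.1 x) :=
  (GamW.coeFn_apply_pair hpq ω hs).trans (hω ▸ GamW₀.coeFn_pair_mk s ω')

variable [Fact (1 ≤ p)]

lemma GamW.norm_apply_le (hpq : p.HolderConjugate q) (ω : GamW μ E q) (v : Gam μ E p) :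
    ‖GamW.apply hpq ω v‖ ≤ ‖GamW.ptNorm ω‖ * ‖v‖ := by
  have h2 : ‖v‖ = (eLpNorm (Gam.val v) p μ).toReal := Lp.norm_def _
  have h3 := GamW.eLpNorm_pair_le hpq ω (Gam.rep v)
  rw [← eLpNorm_congr_ae (Gam.coeFn_rep v)] at h3
  rw [h2, GamW.apply, Lp.norm_toLp, Lp.norm_def, ← ENNReal.toReal_mul]
  exact ENNReal.toReal_mono (ENNReal.mul_ne_top (Lp.eLpNorm_ne_top _) (Gam.memLp v).2.ne) h3

/-- The element of the module dual of `Γ_p(E)` given by pairing with `ω ∈ Γ_q(E'_{w*})`. -/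
def GamW.toDual (hpq : p.HolderConjugate q) (ω : GamW μ E q) : ModuleDual μ (Gam μ E p) :=
  let L : Gam μ E p →ₗ[Linf μ] Lp ℝ 1 μ :=
    { toFun := GamW.apply hpq ω
      map_add' := fun v w => by
        obtain ⟨ω', hω'⟩ := Submodule.mkQ_surjective _ (ω : GamW₀ μ E)
        have h : Gam.val (v + w) =ᵐ[μ] fun x => ((Gam.rep v + Gam.rep w).1 x : B) := by
          filter_upwards [Gam.coeFn_add v w, Gam.coeFn_rep v, Gam.coeFn_rep w] with x h1 h2 h3
          rw [h1, h2, h3]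
          rfl
        refine Lp.ext ?_
        filter_upwards [GamW.coeFn_apply hpq hω' h, GamW.coeFn_apply hpq hω' (Gam.coeFn_rep v),
          GamW.coeFn_apply hpq hω' (Gam.coeFn_rep w),
          Lp.coeFn_add (GamW.apply hpq ω v) (GamW.apply hpq ω w)] with x h1 h2 h3 h4
        rw [h1, h4, Pi.add_apply, h2, h3]
        exact map_add (ω'.1 x) _ _
      map_smul' := fun f v => by
        obtain ⟨ω', hω'⟩ := Submodule.mkQ_surjective _ (ω : GamW₀ μ E)
        have hf := (f : X →ₘ[μ] ℝ).aestronglyMeasurable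
        have h : Gam.val (f • v) =ᵐ[μ] fun x => ((Sec.mul _ hf (Gam.rep v)).1 x : B) := by
          filter_upwards [coeFn_linf_smul f (v : Lp B p μ), Gam.coeFn_rep v] with x h1 h2
          refine h1.trans ?_
          change _ = (f : X →ₘ[μ] ℝ) x • ((Gam.rep v).1 x : B)
          rw [← h2]
        refine Lp.ext ?_
        filter_upwards [GamW.coeFn_apply hpq hω' h, GamW.coeFn_apply hpq hω' (Gam.coeFn_rep v),
          coeFn_linf_smul f (GamW.apply hpq ω v)] with x h1 h2 h3
        rw [RingHom.id_apply, h1, h3, h2]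
        exact (ω'.1 x).map_smul _ _ }
  ⟨L, AddMonoidHomClass.continuous_of_bound L ‖GamW.ptNorm ω‖ (GamW.norm_apply_le hpq ω)⟩

lemma GamW.coeFn_toDual_pair (hpq : p.HolderConjugate q) (ω : GamW μ E q) {v : Gam μ E p}
    {s : Sec μ E} (hs : Gam.val v =ᵐ[μ] fun x => (s.1 x : B)) :
    GamW.toDual hpq ω v =ᵐ[μ] GamW₀.pair s (ω : GamW₀ μ E) :=
  GamW.coeFn_apply_pair hpq ω hs

lemma GamW.coeFn_toDual (hpq : p.HolderConjugate q) {ω : GamW μ E q} {ω' : WSec μ E}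
    (hω : GamW₀.mk ω' = (ω : GamW₀ μ E)) {v : Gam μ E p}
    {s : Sec μ E} (hs : Gam.val v =ᵐ[μ] fun x => (s.1 x : B)) :
    GamW.toDual hpq ω v =ᵐ[μ] fun x => ω'.1 x (s.1 x) :=
  GamW.coeFn_apply hpq hω hs

/-- The map `Γ_q(E'_{w*}) → Γ_p(E)^*` given by the pairing, as an `L^∞`-linear map. -/
def GamW.toDualₗ (hpq : p.HolderConjugate q) : GamW μ E q →ₗ[Linf μ] ModuleDual μ (Gam μ E p) where
  toFun := GamW.toDual hpq
  map_add' ω η := by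
    obtain ⟨ω', hω'⟩ := Submodule.mkQ_surjective _ (ω : GamW₀ μ E)
    obtain ⟨η', hη'⟩ := Submodule.mkQ_surjective _ (η : GamW₀ μ E)
    have h : GamW₀.mk (ω' + η') = ((ω + η : GamW μ E q) : GamW₀ μ E) := by
      rw [Submodule.coe_add, ← hω', ← hη']
      rfl
    refine ContinuousLinearMap.ext fun v => Lp.ext ?_
    filter_upwards [GamW.coeFn_toDual hpq h (Gam.coeFn_rep v),
      GamW.coeFn_toDual hpq hω' (Gam.coeFn_rep v), GamW.coeFn_toDual hpq hη' (Gam.coeFn_rep v),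
      ModuleDual.coeFn_add_apply (GamW.toDual hpq ω) (GamW.toDual hpq η) v] with x h1 h2 h3 h4
    rw [h1, h4, h2, h3]
    rfl
  map_smul' f ω := by
    obtain ⟨ω', hω'⟩ := Submodule.mkQ_surjective _ (ω : GamW₀ μ E)
    have h : GamW₀.mk (WSec.mul (f : X →ₘ[μ] ℝ) ω') = ((f • ω : GamW μ E q) : GamW₀ μ E) := by
      rw [Submodule.coe_smul, ← hω']
      rfl
    refine ContinuousLinearMap.ext fun v => Lp.ext ?_
    filter_upwards [GamW.coeFn_toDual hpq h (Gam.coeFn_rep v),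
      GamW.coeFn_toDual hpq hω' (Gam.coeFn_rep v),
      ModuleDual.coeFn_smul_apply f (GamW.toDual hpq ω) v] with x h1 h2 h3
    rw [RingHom.id_apply, h1, h3, h2]
    rfl

lemma GamW.toDual_injective (hpq : p.HolderConjugate q) :
    Function.Injective (GamW.toDualₗ (μ := μ) (E := E) hpq) := by
  rw [injective_iff_map_eq_zero]
  intro ω h0
  obtain ⟨ω', hω'⟩ := Submodule.mkQ_surjective _ (ω : GamW₀ μ E)
  refine Subtype.ext (hω'.symm.trans ((Submodule.Quotient.mk_eq_zero _).2 fun v => ?_))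
  obtain ⟨A, hA, hev, hmem⟩ := Sec.exists_cutoff v
  have h1 : ∀ n, ∀ᵐ x ∂μ, ω'.1 x ((Sec.cut (hA n) v).1 x) = 0 := by
    intro n
    have h2 := GamW.coeFn_toDual hpq hω' (v := Gam.mk (Sec.cut (hA n) v) (hmem n p))
      (hmem n p).coeFn_toLp
    have h3 : GamW.toDual hpq ω (Gam.mk (Sec.cut (hA n) v) (hmem n p)) = 0 :=
      congrArg (fun T : ModuleDual μ (Gam μ E p) => T (Gam.mk (Sec.cut (hA n) v) (hmem n p))) h0
    rw [h3] at h2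
    filter_upwards [h2, Lp.coeFn_zero ℝ 1 μ] with x h4 h5
    rw [← h4, h5, Pi.zero_apply]
  filter_upwards [hev, ae_all_iff.2 h1] with x h2 h3
  obtain ⟨n, hn⟩ := h2.exists
  have h4 : ω'.1 x (ind (A n) x • v.1 x) = 0 := h3 n
  rwa [ind_of_mem hn, one_smul] at h4

/-- The two pointwise norms agree: the supremum over all sections bounded by `1` is already attained
by the integrable ones, by exhaustion. -/
lemma GamW.dualPtNorm_toDual (hpq : p.HolderConjugate q) (ω : GamW μ E q) :
    dualPtNorm (Gam.ptNorm (μ := μ) (E := E) (p := p)) (GamW.toDual hpq ω) =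
      GamW₀.ptNorm (ω : GamW₀ μ E) := by
  refine le_antisymm ((ModuleDual.isLUB_dualPtNorm _).2 ?_) ((isLUB_famSup _).2 ?_)
  · rintro _ ⟨v, hv, rfl⟩
    refine (isLUB_famSup _).1 ⟨Gam.rep v, ?_, ?_⟩
    · filter_upwards [hv, Gam.coeFn_rep v] with x h1 h2
      rwa [h2] at h1
    · exact congrArg toExt (AEEqFun.ext (GamW.coeFn_toDual_pair hpq ω (Gam.coeFn_rep v)))
  · rintro _ ⟨v, hv, rfl⟩
    obtain ⟨A, hA, hev, hmem⟩ := Sec.exists_cutoff v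
    have h1 : ∀ n, ∀ᵐ x ∂μ, x ∈ A n → ((GamW₀.pair v (ω : GamW₀ μ E) x : ℝ) : EReal) ≤
        dualPtNorm (Gam.ptNorm (μ := μ) (E := E) (p := p)) (GamW.toDual hpq ω) x := by
      intro n
      set w := Gam.mk (Sec.cut (hA n) v) (hmem n p)
      have hw : Gam.val w =ᵐ[μ] fun x => ((Sec.cut (hA n) v).1 x : B) := (hmem n p).coeFn_toLp
      have h2 := AEEqFun.coeFn_le.2 ((ModuleDual.isLUB_dualPtNorm (GamW.toDual hpq ω)).1 ⟨w, by
        filter_upwards [hw, hv] with x h3 h4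
        rw [h3]
        exact (Sec.norm_cut_le (hA n) v x).trans h4, rfl⟩)
      filter_upwards [h2, coeFn_toExt (GamW.toDual hpq ω w : X →ₘ[μ] ℝ),
        GamW.coeFn_toDual_pair hpq ω hw,
        GamW₀.coeFn_pair_mul (memLp_ind (hA n)).1 v (ω : GamW₀ μ E)] with x h3 h4 h5 h6 hx
      rwa [h4, h5, h6, ind_of_mem hx, one_mul] at h3
    rw [← AEEqFun.coeFn_le]
    filter_upwards [hev, ae_all_iff.2 h1, coeFn_toExt (GamW₀.pair v (ω : GamW₀ μ E))]
      with x h2 h3 h4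
    obtain ⟨n, hn⟩ := h2.exists
    rw [h4]
    exact h3 n hn

end Pairing

/-! ### Representation of the module dual by fields of functionals -/

section Representation

open Topology

variable {X : Type*} [MeasurableSpace X] {μ : Measure X}
  {B : Type*} [NormedAddCommGroup B] [NormedSpace ℝ B] {E : BanachBundle X B} {p q : ℝ≥0∞}

omit [NormedSpace ℝ B] in
/-- Almost every point is a Lebesgue point of a bounded strongly measurable function with respect to
a linear lifting: compare `v` with the points of a countable set that is dense in its range. -/
lemma ae_lifting_norm_sub_eq_zero {φ : X → (X → ℝ) → ℝ} (hφ : ∀ x, IsSubstate μ (φ x))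
    (hφ' : ∀ f, MemLp f ∞ μ → ∀ᵐ x ∂μ, φ x f = f x) {v : X → B} (hv : MemLp v ∞ μ) :
    ∀ᵐ x ∂μ, φ x (fun y => ‖v y - v x‖) = 0 := by
  obtain ⟨c, hc, hcl⟩ := hv.1.stronglyMeasurable_mk.isSeparable_range
  have hmem : ∀ b : B, MemLp (fun y => ‖v y - b‖) ∞ μ := fun b => (hv.sub (memLp_top_const b)).norm
  have h1 : ∀ᵐ x ∂μ, ∀ d ∈ c, φ x (fun y => ‖v y - d‖) = ‖v x - d‖ :=
    (ae_ball_iff hc).2 fun d _ => hφ' _ (hmem d)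
  filter_upwards [h1, hv.1.ae_eq_mk] with x h2 h3
  refine le_antisymm (le_of_forall_pos_le_add fun ε hε => ?_)
    ((hφ x).nonneg (hmem _) (ae_of_all _ fun y => norm_nonneg _))
  have hx : v x ∈ closure c := by
    rw [h3]
    exact hcl ⟨x, rfl⟩
  obtain ⟨d, hd, hdist⟩ := Metric.mem_closure_iff.1 hx (ε / 2) (by positivity)
  rw [dist_eq_norm] at hdist
  have hconst : MemLp (fun _ : X => ‖v x - d‖) ∞ μ := memLp_top_const _
  have h4 : φ x (fun y => ‖v y - v x‖) ≤ φ x (fun y => ‖v y - d‖ + ‖v x - d‖) :=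
    (hφ x).mono (hmem _) ((hmem d).add hconst) (ae_of_all _ fun y => by
      rw [norm_sub_rev (v x) d]
      exact norm_sub_le_norm_sub_add_norm_sub _ _ _)
  rw [(hφ x).add (hmem d) hconst, h2 d hd] at h4
  have h5 := (hφ x).const_le (norm_nonneg (v x - d))
  linarith

variable [Fact (1 ≤ p)]

/-- Hahn–Banach extension of `v ↦ φ (T v / h)` from the bounded elements of `Γ_p(E)` to all of
`L^∞(μ; B)`, dominated by `u ↦ φ (|u|)`. -/
lemma exists_extension (T : ModuleDual μ (Gam μ E p)) {h : X → ℝ} (hm : Measurable h)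
    (hT : ∀ v : Gam μ E p, ∀ᵐ x ∂μ, |T v x / h x| ≤ ‖Gam.val v x‖) {φ : (X → ℝ) → ℝ}
    (hφ : IsSubstate μ φ) :
    ∃ L : Lp B ∞ μ →ₗ[ℝ] ℝ, (∀ u, |L u| ≤ φ fun y => ‖u y‖) ∧
      ∀ (u : Lp B ∞ μ) (w : Gam μ E p), u =ᵐ[μ] Gam.val w → L u = φ fun y => T w y / h y := by
  have hmem : ∀ (u : Lp B ∞ μ) (w : Gam μ E p), u =ᵐ[μ] Gam.val w →
      MemLp (fun y => T w y / h y) ∞ μ := by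
    intro u w huw
    refine (Lp.memLp u).mono
      ((Lp.stronglyMeasurable (T w)).measurable.div hm).aestronglyMeasurable ?_
    filter_upwards [hT w, huw] with x h1 h2
    rw [h2]
    exact h1
  have hnorm : ∀ u : Lp B ∞ μ, MemLp (fun y => ‖u y‖) ∞ μ := fun u => (Lp.memLp u).norm
  have hadd : ∀ (u u' : Lp B ∞ μ) (w w' : Gam μ E p), u =ᵐ[μ] Gam.val w → u' =ᵐ[μ] Gam.val w' →
      (u + u' : Lp B ∞ μ) =ᵐ[μ] Gam.val (w + w') := by
    intro u u' w w' h1 h2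
    filter_upwards [h1, h2, Lp.coeFn_add u u', Gam.coeFn_add w w'] with x h3 h4 h5 h6
    rw [h5, h6, Pi.add_apply, h3, h4]
  have hsmul : ∀ (c : ℝ) (u : Lp B ∞ μ) (w : Gam μ E p), u =ᵐ[μ] Gam.val w →
      (c • u : Lp B ∞ μ) =ᵐ[μ] Gam.val (Linf.of (fun _ => c) (memLp_top_const (μ := μ) c) • w) := by
    intro c u w h1
    filter_upwards [h1, Lp.coeFn_smul c u, Gam.coeFn_of_smul (memLp_top_const c) w] with x h3 h4 h5
    rw [h4, h5, Pi.smul_apply, h3]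
  have huniq : ∀ (u : Lp B ∞ μ) (w w' : Gam μ E p), u =ᵐ[μ] Gam.val w → u =ᵐ[μ] Gam.val w' →
      w = w' := fun u w w' h1 h2 => Subtype.ext (Lp.ext (h1.symm.trans h2))
  let D : Submodule ℝ (Lp B ∞ μ) :=
    { carrier := {u | ∃ w : Gam μ E p, u =ᵐ[μ] Gam.val w}
      add_mem' := by
        rintro u u' ⟨w, hw⟩ ⟨w', hw'⟩
        exact ⟨w + w', hadd u u' w w' hw hw'⟩
      zero_mem' := ⟨0, (Lp.coeFn_zero B ∞ μ).trans Gam.coeFn_zero.symm⟩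
      smul_mem' := by
        rintro c u ⟨w, hw⟩
        exact ⟨_, hsmul c u w hw⟩ }
  let F : D →ₗ[ℝ] ℝ :=
    { toFun := fun u => φ fun y => T u.2.choose y / h y
      map_add' := fun u u' => by
        have e : (u + u').2.choose = u.2.choose + u'.2.choose := huniq _ _ _ (u + u').2.choose_spec
          (hadd _ _ _ _ u.2.choose_spec u'.2.choose_spec)
        rw [← hφ.add (hmem _ _ u.2.choose_spec) (hmem _ _ u'.2.choose_spec), e]
        refine hφ.congr ?_
        filter_upwards [ModuleDual.coeFn_map_add T u.2.choose u'.2.choose] with x hx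
        rw [hx, add_div]
      map_smul' := fun c u => by
        have e : (c • u).2.choose =
            Linf.of (fun _ => c) (memLp_top_const (μ := μ) c) • u.2.choose :=
          huniq _ _ _ (c • u).2.choose_spec (hsmul _ _ _ u.2.choose_spec)
        rw [RingHom.id_apply, smul_eq_mul, ← hφ.smul c (hmem _ _ u.2.choose_spec), e]
        refine hφ.congr ?_
        filter_upwards [ModuleDual.coeFn_of_smul T (memLp_top_const c) u.2.choose] with x hx
        rw [hx, mul_div_assoc] }
  have hFle : ∀ u : D, F u ≤ φ fun y => ‖(u : Lp B ∞ μ) y‖ := by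
    intro u
    refine hφ.mono (hmem _ _ u.2.choose_spec) (hnorm _) ?_
    filter_upwards [hT u.2.choose, u.2.choose_spec] with x h1 h2
    rw [h2]
    exact (le_abs_self _).trans h1
  obtain ⟨L, hL1, hL2⟩ := exists_extension_of_le_sublinear ⟨D, F⟩
    (fun u : Lp B ∞ μ => φ fun y => ‖u y‖) (fun c hc u => by
      rw [← hφ.smul c (hnorm u)]
      refine hφ.congr ?_
      filter_upwards [Lp.coeFn_smul c u] with x hx
      rw [hx, Pi.smul_apply, norm_smul, Real.norm_of_nonneg hc.le])
    (fun u w => by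
      rw [← hφ.add (hnorm u) (hnorm w)]
      refine hφ.mono (hnorm _) ((hnorm u).add (hnorm w)) ?_
      filter_upwards [Lp.coeFn_add u w] with x hx
      rw [hx, Pi.add_apply]
      exact norm_add_le _ _) hFle
  refine ⟨L, fun u => abs_le'.2 ⟨hL2 u, ?_⟩, fun u w huw => ?_⟩
  · rw [← map_neg]
    refine (hL2 (-u)).trans_eq (hφ.congr ?_)
    filter_upwards [Lp.coeFn_neg u] with x hx
    rw [hx, Pi.neg_apply, norm_neg]
  · have hu : u ∈ D := ⟨w, huw⟩
    have h1 := hL1 ⟨u, hu⟩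
    rw [h1]
    change (φ fun y => T hu.choose y / h y) = _
    rw [huniq u _ _ hu.choose_spec huw]

/-- Representation of the elements of the module dual by fields of functionals, on bounded
sections: `ω x` is the restriction to constants of the Hahn–Banach extension at `x`, rescaled. -/
lemma exists_field [SigmaFinite μ] (T : ModuleDual μ (Gam μ E p)) {g : X → ℝ} (hg : Measurable g)
    (hT : ∀ v : Gam μ E p, ∀ᵐ x ∂μ, |T v x| ≤ g x * ‖Gam.val v x‖) :
    ∃ ω : ∀ x, StrongDual ℝ (E.fiber x), ∀ (v : Sec μ E)
      (hv : MemLp (fun x => (v.1 x : B)) p μ), MemLp (fun x => (v.1 x : B)) ∞ μ →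
      ∀ᵐ x ∂μ, ω x (v.1 x) = T (Gam.mk v hv) x := by
  obtain ⟨φ, hφ, hφ'⟩ := exists_linear_lifting μ
  -- The summand `1` keeps the denominator positive where `g` vanishes.
  set h : X → ℝ := fun x => 1 + |g x| with hh
  have hh0 : ∀ x, 0 < h x := fun x => by positivity
  have hhm : Measurable h := hg.abs.const_add 1
  have hTh : ∀ v : Gam μ E p, ∀ᵐ x ∂μ, |T v x / h x| ≤ ‖Gam.val v x‖ := by
    intro v
    filter_upwards [hT v] with x hx
    rw [abs_div, abs_of_pos (hh0 x), div_le_iff₀ (hh0 x), mul_comm]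
    refine hx.trans (mul_le_mul_of_nonneg_right ?_ (norm_nonneg _))
    exact (le_abs_self _).trans (le_add_of_nonneg_left zero_le_one)
  choose L hL1 hL2 using fun x => exists_extension T hhm hTh (hφ x)
  let C : B →ₗ[ℝ] Lp B ∞ μ :=
    { toFun := fun b => (memLp_top_const b).toLp fun _ => b
      map_add' := fun _ _ => rfl
      map_smul' := fun _ _ => rfl }
  have hC : ∀ b, C b =ᵐ[μ] fun _ => b := fun b => MemLp.coeFn_toLp (memLp_top_const b)
  have hbound : ∀ x b, ‖(h x • (L x ∘ₗ C)) b‖ ≤ h x * ‖b‖ := by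
    intro x b
    change ‖h x * L x (C b)‖ ≤ _
    rw [norm_mul, Real.norm_of_nonneg (hh0 x).le]
    refine mul_le_mul_of_nonneg_left ((hL1 x (C b)).trans ?_) (hh0 x).le
    refine le_trans (le_of_eq ((hφ x).congr ?_)) ((hφ x).const_le (norm_nonneg b))
    filter_upwards [hC b] with y hy
    rw [hy]
  refine ⟨fun x => (LinearMap.mkContinuous (h x • (L x ∘ₗ C)) (h x) (hbound x)).comp
    (E.fiber x).subtypeL, fun v hv hv' => ?_⟩
  set w := Gam.mk v hv
  have hw : hv'.toLp =ᵐ[μ] Gam.val w := hv'.coeFn_toLp.trans hv.coeFn_toLp.symm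
  have hmem : MemLp (fun y => T w y / h y) ∞ μ := by
    refine hv'.mono ((Lp.stronglyMeasurable (T w)).measurable.div hhm).aestronglyMeasurable ?_
    filter_upwards [hTh w, hv.coeFn_toLp] with x h1 h2
    rw [← h2]
    exact h1
  filter_upwards [hφ' _ hmem, ae_lifting_norm_sub_eq_zero hφ hφ' hv'] with x h1 h2
  change h x * L x (C (v.1 x)) = T w x
  have h3 : |L x (hv'.toLp - C (v.1 x))| ≤ 0 := by
    refine (hL1 x _).trans (le_of_eq (Eq.trans ((hφ x).congr ?_) h2))
    filter_upwards [Lp.coeFn_sub hv'.toLp (C (v.1 x)), hv'.coeFn_toLp, hC (v.1 x)] with y h4 h5 h6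
    rw [h4, Pi.sub_apply, h5, h6]
  have h4 : L x (C (v.1 x)) = T w x / h x := by
    have := abs_nonpos_iff.1 h3
    rw [map_sub, sub_eq_zero, hL2 x _ w hw, h1] at this
    exact this.symm
  rw [h4, mul_div_cancel₀ _ (hh0 x).ne']

/-- The pairing map is onto: a field representing `T` on bounded sections represents it on all
sections, by exhaustion. -/
lemma GamW.toDual_surjective [SigmaFinite μ] (hp₁ : 1 < p) (hp : p ≠ ∞)
    (hpq : p.HolderConjugate q) :
    Function.Surjective (GamW.toDualₗ (μ := μ) (E := E) hpq) := by
  intro T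
  obtain ⟨K, hK, hTK⟩ := ModuleDual.exists_norm_bound T
  obtain ⟨g, hg, -, hTg⟩ := ModuleDual.exists_dominating hp₁ hp hpq T hTK
  have hT := ModuleDual.abs_le_of_le T hTg
  have hgm : g =ᵐ[μ] hg.1.mk g := hg.1.ae_eq_mk
  obtain ⟨ω, hω⟩ := exists_field T hg.1.stronglyMeasurable_mk.measurable (fun v => by
    filter_upwards [hT v, hgm] with x h1 h2
    rwa [← h2])
  have hcut : ∀ (v : Sec μ E) {A : Set X} (hA : MeasurableSet A) (x : X),
      ω x ((Sec.cut hA v).1 x) = ind A x * ω x (v.1 x) := fun v A hA x =>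
    (ω x).map_smul (ind A x) (v.1 x)
  have hωm : ω ∈ WSec μ E := by
    intro v
    obtain ⟨A, hA, hev, hmem⟩ := Sec.exists_cutoff v
    refine aestronglyMeasurable_of_tendsto_ae atTop
      (f := fun n => (T (Gam.mk (Sec.cut (hA n) v) (hmem n p)) : X → ℝ))
      (fun n => Lp.aestronglyMeasurable _) ?_
    filter_upwards [hev, ae_all_iff.2 fun n => hω _ (hmem n p) (hmem n ∞)] with x h1 h2
    refine tendsto_const_nhds.congr' ?_
    filter_upwards [h1] with n hn
    rw [← h2 n, hcut, ind_of_mem hn, one_mul]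
  have hle : ∀ v : Sec μ E, (∀ᵐ x ∂μ, ‖v.1 x‖ ≤ 1) →
      ∀ᵐ x ∂μ, GamW₀.pair v (GamW₀.mk ⟨ω, hωm⟩) x ≤ g x := by
    intro v hv
    obtain ⟨A, hA, hev, hmem⟩ := Sec.exists_cutoff v
    have h1 : ∀ n, ∀ᵐ x ∂μ, T (Gam.mk (Sec.cut (hA n) v) (hmem n p)) x ≤ g x := by
      intro n
      refine hTg _ ?_
      filter_upwards [(hmem n p).coeFn_toLp, hv] with x h2 h3
      exact (congrArg norm h2).trans_le ((Sec.norm_cut_le (hA n) v x).trans h3)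
    filter_upwards [hev, ae_all_iff.2 h1, ae_all_iff.2 fun n => hω _ (hmem n p) (hmem n ∞),
      GamW₀.coeFn_pair_mk v ⟨ω, hωm⟩] with x h2 h3 h4 h5
    obtain ⟨n, hn⟩ := h2.exists
    have h6 := h3 n
    rw [← h4 n, hcut, ind_of_mem hn, one_mul] at h6
    exact h5.trans_le h6
  refine ⟨⟨GamW₀.mk ⟨ω, hωm⟩, GamW₀.exists_of_le _ g hg hle⟩, ?_⟩
  refine ContinuousLinearMap.ext fun v => Lp.ext ?_
  refine (GamW.coeFn_toDual hpq (ω' := ⟨ω, hωm⟩) rfl (Gam.coeFn_rep v)).trans ?_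
  obtain ⟨A, hA, hev, hmem⟩ := Sec.exists_cutoff (Gam.rep v)
  have h1 : ∀ n, ∀ᵐ x ∂μ, ind (A n) x * ω x ((Gam.rep v).1 x) = ind (A n) x * T v x := by
    intro n
    have e : Gam.mk (Sec.cut (hA n) (Gam.rep v)) (hmem n p) =
        Linf.of (ind (A n)) (memLp_ind (μ := μ) (hA n)) • v := by
      refine Subtype.ext (Lp.ext ((hmem n p).coeFn_toLp.trans ?_))
      filter_upwards [Gam.coeFn_of_smul (memLp_ind (hA n)) v, Gam.coeFn_rep v] with x h2 h3
      refine Eq.trans ?_ h2.symm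
      rw [h3]
      rfl
    filter_upwards [hω _ (hmem n p) (hmem n ∞), ModuleDual.coeFn_of_smul T (memLp_ind (hA n)) v]
      with x h2 h3
    rw [← hcut (Gam.rep v) (hA n), h2, e, h3]
  filter_upwards [hev, ae_all_iff.2 h1] with x h2 h3
  obtain ⟨n, hn⟩ := h2.exists
  have h4 := h3 n
  rwa [ind_of_mem hn, one_mul, one_mul] at h4

end Representation

/-- A pointwise norm that corresponds to a complete one under an `L^∞`-linear bijection is
complete. -/
lemma IsLpBanachModule.of_equiv {X : Type*} [MeasurableSpace X] {μ : Measure X} {q : ℝ≥0∞}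
    {M M' : Type*} [AddCommGroup M] [Module (Linf μ) M] [AddCommGroup M'] [Module (Linf μ) M']
    {N : M → Lp ℝ q μ} {N' : M' → Lp ℝ q μ} (h : IsLpBanachModule q N) (I : M' ≃ₗ[Linf μ] M)
    (hI : ∀ ω, N (I ω) = N' ω) : IsLpBanachModule q N' where
  nonneg ω := hI ω ▸ h.nonneg (I ω)
  eq_zero_iff ω := by
    rw [← hI, h.eq_zero_iff]
    exact I.map_eq_zero_iff
  add_le ω η := by
    have := h.add_le (I ω) (I η)
    rwa [← map_add, hI, hI, hI] at this
  smul_eq f ω := by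
    have := h.smul_eq f (I ω)
    rwa [← map_smul, hI, hI] at this
  complete u hu := by
    obtain ⟨T, hT⟩ := h.complete (fun n => I (u n)) (by
      simpa only [← map_sub, hI] using hu)
    refine ⟨I.symm T, ?_⟩
    simpa only [← hI, map_sub, LinearEquiv.apply_symm_apply] using hT

end BundleDual

end

open BundleDual in
theorem theorem3p6 {X : Type*} [MeasurableSpace X] (μ : Measure X) [SigmaFinite μ]
    {B : Type*} [NormedAddCommGroup B] [NormedSpace ℝ B] [CompleteSpace B]
    (E : BanachBundle X B) (p q : ℝ≥0∞) [Fact (1 ≤ p)] (hp₁ : 1 < p) (hp : p ≠ ∞)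
    (hpq : p.HolderConjugate q) :
    ∃ (N : ModuleDual μ (Gam μ E p) → Lp ℝ q μ)
      (I : GamW μ E q ≃ₗ[Linf μ] ModuleDual μ (Gam μ E p)),
      (∀ T, toExt (N T : X →ₘ[μ] ℝ) = dualPtNorm (Gam.ptNorm (μ := μ) (E := E) (p := p)) T) ∧
      IsLpBanachModule q N ∧
      (∀ (ω : WSec μ E) (hω : GamW₀.mk ω ∈ GamW μ E q)
        (v : Sec μ E) (hv : MemLp (fun x => (v.1 x : B)) p μ),
        I ⟨GamW₀.mk ω, hω⟩ (Gam.mk v hv) =ᵐ[μ] fun x => ω.1 x (v.1 x)) ∧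
      (∀ ω : GamW μ E q, N (I ω) = GamW.ptNorm ω) ∧
      IsLpBanachModule q (GamW.ptNorm (μ := μ) (E := E) (q := q)) := by
  have hex : ∀ T : ModuleDual μ (Gam μ E p), ∃ k : Lp ℝ q μ, toExt (k : X →ₘ[μ] ℝ) =
      dualPtNorm (Gam.ptNorm (μ := μ) (E := E) (p := p)) T := fun T => by
    obtain ⟨K, hK, hT⟩ := ModuleDual.exists_norm_bound T
    obtain ⟨k, hk, -⟩ := ModuleDual.exists_ptNorm hp₁ hp hpq T hK hT
    exact ⟨k, hk⟩
  choose N hN using hex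
  have hI : ∀ ω : GamW μ E q, N (GamW.toDual hpq ω) = GamW.ptNorm ω := fun ω =>
    Subtype.ext (toExt_injective (((hN _).trans (GamW.dualPtNorm_toDual hpq ω)).trans
      (GamW.toExt_ptNorm ω).symm))
  have hB : IsLpBanachModule q N := ModuleDual.isLpBanachModule hN hp₁ hp hpq
  let I : GamW μ E q ≃ₗ[Linf μ] ModuleDual μ (Gam μ E p) :=
    LinearEquiv.ofBijective (GamW.toDualₗ hpq)
      ⟨GamW.toDual_injective hpq, GamW.toDual_surjective hp₁ hp hpq⟩
  exact ⟨N, I, hN, hB, fun ω hω v hv => GamW.coeFn_toDual hpq rfl hv.coeFn_toLp, hI,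
    hB.of_equiv I hI⟩
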